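/- Let $\mathcal H_1,\mathcal H_2$ be separable real or complex Hilbert spaces and $S_2=S_2(\mathcal H_1,\mathcal H_2)$ the space of Hilbert–Schmidt operators with the Hilbert–Schmidt norm; write $(w\otimes v)\phi=\langle\phi,v\rangle w$. A singular value decomposition (SVD) of $A\in S_2$ is a representation $A=\sum_{j\in\mathbb N}s_j\,w_j\otimes v_j$ with $s_j\ge 0$ in which the vectors $v_j$ with $s_j\neq0$ are orthonormal in $\mathcal H_1$ and the vectors $w_j$ with $s_j\ne 0$ are orthonormal in $\mathcal H_2$. Let $f:[0,\infty)\to\mathbb R$ be Lipschitz with constant $L_f$ and $f(0)=0$. *Network class.* Fix a set $\mathcal A$ of measurable activations $\mathbb R\to\mathbb R$ and a height $\mathfrak h\ge1$. Consider scalar nested networks $\mathbb R\to\mathbb R$ of height $\mathfrak h$: height $1$ means feedforward networks with activations in $\mathcal A$; in height $\mathfrak h+1$ finitely many networks of height $\mathfrak h$ may in addition serve as activations. The number of parameters is the number of nonzero weights and biases, those of a network serving as an activation being counted once. Let $\beta,\kappa\ge0$ and assume that there is $K>0$ such that for every $L>0$, every $L$-Lipschitz $g:[0,1]\to\mathbb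 R$ and every $\varepsilon\in(0,1]$ some network $\tilde g$ of the class with at most $K\varepsilon^{-\beta}(1+|\log\varepsilon|)^\kappa$ parameters satisfies $\|g-\tilde g\|_{L^2([0,1])}\le L\varepsilon$. *Cube and measure.* Let $(\omega_j)_{j\in\mathbb N}$ be a non-increasing sequence of positive weights with $\omega\in\ell^{1+\eta}$ for all $\eta>0$, and let $r>0$, $s>1/2$. Let $C_r^s\subset S_2$ be the set of operators that have an SVD with $s_j\le r\,\omega_j^s$ for all $j$. For orthonormal sequences $v=(v_j)$ in $\mathcal H_1$ and $w=(w_j)$ in $\mathcal H_2$ put $\sigma_{v,w}(u)=r\sum_j\omega_j^s u_j\,w_j\otimes v_j$ for $u\in U=[-1,1]^{\mathbb N}$, and let $\mu_{v,w}=(\sigma_{v,w})_\#\mathcal P_U$, where $\mathcal P_U=\bigotimes_j\frac{\lambda}{2}$ is the uniform product probability measure on $U$. For $N\in\mathbb N_0$ and $\varphi_j:\mathbb R\to\mathbb R$ define the operator network $$\mathcal D_{v,w}[\varphi_0,\dots,\varphi_{N-1}](A)=\sum_{j<N}\varphi_j(|c_j|)\,\frac{c_j}{|c_j|}\,w_j\otimes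 v_j,\qquad c_j=\langle Av_j,w_j\rangle ,$$ with the $j$-th summand read as $0$ when $c_j=0$. (For $A=\sum_jc_j\,w_j\otimes v_j$ it applies $\varphi_j$ to the singular value $|c_j|$ and keeps the singular vectors $v_j$ and $\frac{c_j}{|c_j|}w_j$.) Then the following holds. 1. Every $A\in S_2$ has an SVD, the series $\mathcal G(f)(A)=\sum_{j}f(s_j)\,w_j\otimes v_j$ converges in $S_2$ for every SVD of $A$, and its value does not depend on the SVD. The map $\mathcal G(f):S_2\to S_2$ is Lipschitz with constant $L_f$. 2. For all orthonormal sequences $v,w$ and all $u\in U$, the operator $\sigma_{v,w}(u)$ has the SVD with singular values $r\omega_j^s|u_j|$, right singular vectors $v_j$ and left singular vectors $\mathrm{sgn}(u_j)w_j$; in particular $\sigma_{v,w}(u)\in C_r^s$. 3. For every $\varepsilon\in(0,1]$ there are $N_\varepsilon$ and scalar networks $\varphi_{\varepsilon,0},\dots,\varphi_{\varepsilon,N_\varepsilon-1}$ of the class, with $\mathcal N_{para}(\varepsilon)$ parameters in total, such that for all orthonormal sequences $v$, $w$ $$\big\|\mathcal G(f)-\mathcal D_{v,w}[\varphi_{\varepsilon,0},\dots,\varphi_{\varepsilon,N_\varepsilon-1}]\big\|_{L^2(C_r^s,\mu_{v,w};S_2)}\le\varepsilon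 ,$$ and for every $\delta>0$ there is $C_\delta>0$ such that for all $\varepsilon\in(0,1]$ $$\mathcal N_{para}(\varepsilon)\le C_\delta\,\varepsilon^{-1/(s-1/2)-\beta-\delta}(1+|\log\varepsilon|)^\kappa .$$ 4. For every $\varepsilon\in(0,1]$ there are also $N_\varepsilon$ and one common scalar network $\varphi_\varepsilon$ of the class, with $p_\varepsilon$ parameters, such that for all orthonormal sequences $v$, $w$ the network with $\varphi_{\varepsilon,j}=\varphi_\varepsilon$ for all $j<N_\varepsilon$ satisfies the error bound of part 3, and for every $\delta>0$ there is $C_\delta>0$ such that for all $\varepsilon\in(0,1]$ $$N_\varepsilon\,p_\varepsilon\le C_\delta\,\varepsilon^{-1/(s-1/2)-\frac{3s}{2s-1}\beta-\delta}(1+|\log\varepsilon|)^\kappa .$$ In particular, for $\beta=0$ the rate of part 3 is attained with one common scalar surrogate of $f$. -/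

import Mathlib

open MeasureTheory Set
open scoped NNReal ENNReal BigOperators InnerProductSpace

noncomputable section

section HilbertSchmidt

variable (𝕜 : Type*) [RCLike 𝕜]
variable (H₁ : Type*) [NormedAddCommGroup H₁] [InnerProductSpace 𝕜 H₁] [CompleteSpace H₁]
variable (H₂ : Type*) [NormedAddCommGroup H₂] [InnerProductSpace 𝕜 H₂]

/-- The index set of a Hilbert basis of `H₁`, fixed once and for all. -/
def refIndex : Set H₁ := (exists_hilbertBasis 𝕜 H₁).choose

/-- A Hilbert basis of `H₁`, fixed once and for all; the Hilbert-Schmidt class and norm do not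
depend on it, see `hs_sum_eq_of_bases`. -/
def refBasis : HilbertBasis (refIndex 𝕜 H₁) 𝕜 H₁ :=
  (exists_hilbertBasis 𝕜 H₁).choose_spec.choose

/-- The bounded operators `A` with `∑ i, ‖A bᵢ‖ ^ 2 < ∞`. -/
def hsSubmodule : Submodule 𝕜 (H₁ →L[𝕜] H₂) where
  carrier := {A | Memℓp (fun i : refIndex 𝕜 H₁ => A (refBasis 𝕜 H₁ i)) 2}
  zero_mem' := by
    show Memℓp (fun i : refIndex 𝕜 H₁ => (0 : H₁ →L[𝕜] H₂) (refBasis 𝕜 H₁ i)) 2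
    exact (zero_memℓp (E := fun _ : refIndex 𝕜 H₁ => H₂) (p := 2))
  add_mem' := fun {_ _} hA hB => Memℓp.add hA hB
  smul_mem' := fun c _ hA => Memℓp.const_smul hA c

/-- The space `S₂(H₁, H₂)` of Hilbert-Schmidt operators. -/
def HS : Type _ := hsSubmodule 𝕜 H₁ H₂

instance : AddCommGroup (HS 𝕜 H₁ H₂) := inferInstanceAs (AddCommGroup (hsSubmodule 𝕜 H₁ H₂))

instance : Module 𝕜 (HS 𝕜 H₁ H₂) := inferInstanceAs (Module 𝕜 (hsSubmodule 𝕜 H₁ H₂))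

variable {𝕜 H₁ H₂}

/-- A Hilbert-Schmidt operator as a bounded operator. -/
def HS.op (A : HS 𝕜 H₁ H₂) : H₁ →L[𝕜] H₂ := A.1

variable (𝕜 H₁ H₂)

/-- `A ↦ (A bᵢ)ᵢ`, whose `ℓ²` norm is the Hilbert-Schmidt norm of `A`. -/
def hsCoord : HS 𝕜 H₁ H₂ →ₗ[𝕜] lp (fun _ : refIndex 𝕜 H₁ => H₂) 2 where
  toFun A := ⟨fun i => A.op (refBasis 𝕜 H₁ i), A.2⟩
  map_add' _ _ := rfl
  map_smul' _ _ := rfl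

theorem hsCoord_injective : Function.Injective (hsCoord 𝕜 H₁ H₂) := by
  intro A B hAB
  apply Subtype.ext
  have h : ∀ i, A.op (refBasis 𝕜 H₁ i) = B.op (refBasis 𝕜 H₁ i) := fun i =>
    congrFun (congrArg Subtype.val hAB) i
  have hd : Dense ((Submodule.span 𝕜 (Set.range (refBasis 𝕜 H₁)) : Submodule 𝕜 H₁) : Set H₁) :=
    Submodule.dense_iff_topologicalClosure_eq_top.mpr (refBasis 𝕜 H₁).dense_span
  refine ContinuousLinearMap.ext_on hd ?_
  rintro _ ⟨i, rfl⟩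
  exact h i

instance : NormedAddCommGroup (HS 𝕜 H₁ H₂) :=
  NormedAddCommGroup.induced (HS 𝕜 H₁ H₂) (lp (fun _ : refIndex 𝕜 H₁ => H₂) 2)
    (hsCoord 𝕜 H₁ H₂) (hsCoord_injective 𝕜 H₁ H₂)

instance : NormedSpace 𝕜 (HS 𝕜 H₁ H₂) :=
  NormedSpace.induced 𝕜 (HS 𝕜 H₁ H₂) (lp (fun _ : refIndex 𝕜 H₁ => H₂) 2) (hsCoord 𝕜 H₁ H₂)

instance : MeasurableSpace (HS 𝕜 H₁ H₂) := borel _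

instance : BorelSpace (HS 𝕜 H₁ H₂) := ⟨rfl⟩

variable {𝕜 H₁ H₂}

theorem hilbertBasis_tsum_enorm_sq {E : Type*} [NormedAddCommGroup E] [InnerProductSpace 𝕜 E]
    {ι : Type*} (b : HilbertBasis ι 𝕜 E) (x : E) :
    ∑' i, ‖⟪b i, x⟫_𝕜‖ₑ ^ 2 = ‖x‖ₑ ^ 2 := by
  have h := lp.hasSum_norm (p := 2) (by norm_num) (b.repr x)
  have h2 : HasSum (fun i => ‖⟪b i, x⟫_𝕜‖ ^ 2) (‖x‖ ^ 2) := by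
    have := h
    simp only [ENNReal.toReal_ofNat, Real.rpow_ofNat, LinearIsometryEquiv.norm_map,
      b.repr_apply_apply] at this
    exact this
  have h3 := h2.tsum_eq
  have h4 : ∀ y : E, ‖y‖ₑ ^ 2 = ENNReal.ofReal (‖y‖ ^ 2) := fun y => by
    rw [← ofReal_norm, ENNReal.ofReal_pow (norm_nonneg _)]
  have h5 : ∀ y : 𝕜, ‖y‖ₑ ^ 2 = ENNReal.ofReal (‖y‖ ^ 2) := fun y => by
    rw [← ofReal_norm, ENNReal.ofReal_pow (norm_nonneg _)]
  rw [h4, ← h3, ENNReal.ofReal_tsum_of_nonneg (fun _ => by positivity) h2.summable]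
  simp only [h5]

theorem hs_sum_eq_adjoint [CompleteSpace H₂] {ι ι' : Type*} (b : HilbertBasis ι 𝕜 H₁)
    (c : HilbertBasis ι' 𝕜 H₂) (A : H₁ →L[𝕜] H₂) :
    ∑' i, ‖A (b i)‖ₑ ^ 2 = ∑' k, ‖(ContinuousLinearMap.adjoint A) (c k)‖ₑ ^ 2 := by
  simp_rw [← hilbertBasis_tsum_enorm_sq c (A _),
    ← hilbertBasis_tsum_enorm_sq b ((ContinuousLinearMap.adjoint A) _)]
  rw [ENNReal.tsum_comm]
  refine tsum_congr fun k => tsum_congr fun i => ?_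
  rw [ContinuousLinearMap.adjoint_inner_right, ← ofReal_norm, ← ofReal_norm, norm_inner_symm]

/-- The Hilbert-Schmidt sum does not depend on the Hilbert basis. -/
theorem hs_sum_eq_of_bases [CompleteSpace H₂] {ι ι' : Type*} (b : HilbertBasis ι 𝕜 H₁)
    (b' : HilbertBasis ι' 𝕜 H₁) (A : H₁ →L[𝕜] H₂) :
    ∑' i, ‖A (b i)‖ₑ ^ 2 = ∑' i, ‖A (b' i)‖ₑ ^ 2 := by
  rw [hs_sum_eq_adjoint b (refBasis 𝕜 H₂), hs_sum_eq_adjoint b' (refBasis 𝕜 H₂)]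

theorem rankOne_mem_hs (w : H₂) (v : H₁) :
    InnerProductSpace.rankOne 𝕜 w v ∈ hsSubmodule 𝕜 H₁ H₂ := by
  show Memℓp (fun i : refIndex 𝕜 H₁ => InnerProductSpace.rankOne 𝕜 w v (refBasis 𝕜 H₁ i)) 2
  refine memℓp_gen ?_
  have h : Summable fun i => ‖⟪refBasis 𝕜 H₁ i, v⟫_𝕜‖ ^ 2 :=
    (refBasis 𝕜 H₁).orthonormal.inner_products_summable v
  refine (h.mul_right (‖w‖ ^ 2)).congr fun i => ?_
  simp only [InnerProductSpace.rankOne_apply, norm_smul, ENNReal.toReal_ofNat, Real.rpow_ofNat,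
    mul_pow, norm_inner_symm v]

/-- The dyad `w ⊗ v : φ ↦ ⟨φ, v⟩ w` (linear in `φ`), as a Hilbert-Schmidt operator. -/
def dyad (w : H₂) (v : H₁) : HS 𝕜 H₁ H₂ :=
  ⟨InnerProductSpace.rankOne 𝕜 w v, rankOne_mem_hs w v⟩

/-- `A = ∑ⱼ sⱼ wⱼ ⊗ vⱼ` (convergence of the partial sums over finite sets in operator norm) is a
singular value decomposition: `sⱼ ≥ 0`, and the `vⱼ` with `sⱼ ≠ 0` as well as the `wⱼ` with
`sⱼ ≠ 0` are orthonormal. -/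
structure IsSVD (A : HS 𝕜 H₁ H₂) (s : ℕ → ℝ≥0) (v : ℕ → H₁) (w : ℕ → H₂) : Prop where
  right_orthonormal : Orthonormal 𝕜 (fun j : {j // s j ≠ 0} => v j)
  left_orthonormal : Orthonormal 𝕜 (fun j : {j // s j ≠ 0} => w j)
  hasSum : HasSum (fun j => ((s j : ℝ) : 𝕜) • (dyad (w j) (v j) : HS 𝕜 H₁ H₂).op) A.op

open Classical in
/-- The singular value functional calculus `A ↦ ∑ⱼ f(sⱼ) wⱼ ⊗ vⱼ` (series in `S₂`). -/
def svCalc (f : ℝ≥0 → ℝ) (A : HS 𝕜 H₁ H₂) : HS 𝕜 H₁ H₂ :=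
  if h : ∃ d : (ℕ → ℝ≥0) × (ℕ → H₁) × (ℕ → H₂), IsSVD A d.1 d.2.1 d.2.2 then
    ∑' j, ((f (h.choose.1 j) : ℝ) : 𝕜) • dyad (h.choose.2.2 j) (h.choose.2.1 j)
  else 0

/-- The cube `C_r^s`: the operators having a singular value decomposition with
`sⱼ ≤ r ωⱼ ^ s` for all `j`. For non-increasing weights it makes no difference whether the
singular values are required to be listed in non-increasing order. -/
def hsCube (𝕜 : Type*) [RCLike 𝕜]
    (H₁ : Type*) [NormedAddCommGroup H₁] [InnerProductSpace 𝕜 H₁] [CompleteSpace H₁]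
    (H₂ : Type*) [NormedAddCommGroup H₂] [InnerProductSpace 𝕜 H₂]
    (ω : ℕ → ℝ) (r s : ℝ) : Set (HS 𝕜 H₁ H₂) :=
  {A | ∃ (a : ℕ → ℝ≥0) (v : ℕ → H₁) (w : ℕ → H₂), IsSVD A a v w ∧ ∀ j, (a j : ℝ) ≤ r * ω j ^ s}

/-- The parametrisation `σ_r^s(u) = r ∑ⱼ ωⱼ ^ s uⱼ wⱼ ⊗ vⱼ` of operators in the cube. -/
def hsSigma (ω : ℕ → ℝ) (r s : ℝ) (v : ℕ → H₁) (w : ℕ → H₂) (u : ℕ → Icc (-1 : ℝ) 1) :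
    HS 𝕜 H₁ H₂ :=
  ∑' j, ((r * ω j ^ s * (u j : ℝ) : ℝ) : 𝕜) • dyad (w j) (v j)

/-- The `j`-th diagonal coefficient `⟨A vⱼ, wⱼ⟩` of `A` with respect to the dyads `wⱼ ⊗ vⱼ`. -/
def hsDiag (v : ℕ → H₁) (w : ℕ → H₂) (A : HS 𝕜 H₁ H₂) (j : ℕ) : 𝕜 := ⟪w j, A.op (v j)⟫_𝕜

/-- The operator network `A ↦ ∑_{j < N} φⱼ(|cⱼ|) (cⱼ / |cⱼ|) wⱼ ⊗ vⱼ`, where `cⱼ = ⟨A vⱼ, wⱼ⟩`.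
If `A = ∑ⱼ cⱼ wⱼ ⊗ vⱼ`, then `|cⱼ|` are the singular values of `A`, with right and left singular
vectors `vⱼ` and `(cⱼ / |cⱼ|) wⱼ`, and the network applies `φⱼ` to the `j`-th singular value. -/
def svNetwork (v : ℕ → H₁) (w : ℕ → H₂) (N : ℕ) (φ : ℕ → ℝ → ℝ) (A : HS 𝕜 H₁ H₂) :
    HS 𝕜 H₁ H₂ :=
  ∑ j ∈ Finset.range N,
    ((φ j ‖hsDiag v w A j‖ : 𝕜) * (hsDiag v w A j / (‖hsDiag v w A j‖ : 𝕜))) • dyad (w j) (v j)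

end HilbertSchmidt

section Measure

/-- The uniform probability measure `λ / 2` on `[-1, 1]`. -/
def uniformIcc : Measure (Icc (-1 : ℝ) 1) := (2 : ℝ≥0∞)⁻¹ • (volume : Measure ℝ).comap Subtype.val

instance : IsProbabilityMeasure uniformIcc := by
  constructor
  have h : (volume : Measure ℝ).comap (Subtype.val : Icc (-1 : ℝ) 1 → ℝ) univ = 2 := by
    rw [(MeasurableEmbedding.subtype_coe measurableSet_Icc).comap_apply, image_univ,
      Subtype.range_coe, Real.volume_Icc]
    norm_num
  rw [uniformIcc, Measure.smul_apply, h, smul_eq_mul]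
  exact ENNReal.inv_mul_cancel (by norm_num) (by norm_num)

/-- The product measure `P_U` on `U = [-1, 1]^ℕ`. -/
def cubeMeasure : Measure (ℕ → Icc (-1 : ℝ) 1) := Measure.infinitePi fun _ => uniformIcc

end Measure

section Networks

/-- The number of nonzero weights and biases of the affine map `x ↦ W x + b`. -/
def affineSize {k m : ℕ} (W : Matrix (Fin m) (Fin k) ℝ) (b : Fin m → ℝ) : ℕ :=
  {q : Fin m × Fin k | W q.1 q.2 ≠ 0}.ncard + {i : Fin m | b i ≠ 0}.ncard

/-- `IsFeedforward 𝒜 m d F n`: the map `F : ℝ^d → ℝ^m` is realised by a feedforward network with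
activations from `𝒜` (each neuron may use its own) and `n` nonzero weights and biases. -/
inductive IsFeedforward (𝒜 : Set (ℝ → ℝ)) (m : ℕ) :
    (d : ℕ) → ((Fin d → ℝ) → (Fin m → ℝ)) → ℕ → Prop
  | output {d : ℕ} (W : Matrix (Fin m) (Fin d) ℝ) (b : Fin m → ℝ) :
      IsFeedforward 𝒜 m d (fun x => W.mulVec x + b) (affineSize W b)
  | hidden {d k n : ℕ} (W : Matrix (Fin k) (Fin d) ℝ) (b : Fin k → ℝ) (a : Fin k → ℝ → ℝ)
      (F : (Fin k → ℝ) → (Fin m → ℝ)) (ha : ∀ i, a i ∈ 𝒜) (hF : IsFeedforward 𝒜 m k F n) :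
      IsFeedforward 𝒜 m d (fun x => F fun i => a i ((W.mulVec x + b) i)) (affineSize W b + n)

/-- `IsScalarNet 𝒜 h φ n`: the function `φ : ℝ → ℝ` is realised by a nested network of height `h`
over the activations `𝒜` with `n` parameters. Height `1` is a feedforward network; in a network of
height `h + 1` finitely many networks `ρᵢ` of height `h`, whose parameters are counted once, serve
as activations besides those of `𝒜`. -/
def IsScalarNet (𝒜 : Set (ℝ → ℝ)) : ℕ → (ℝ → ℝ) → ℕ → Prop
  | 0, φ, n => φ ∈ 𝒜 ∧ n = 0
  | h + 1, φ, n =>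
      ∃ (q : ℕ) (ρ : Fin q → ℝ → ℝ) (p : Fin q → ℕ) (F : (Fin 1 → ℝ) → (Fin 1 → ℝ)) (k : ℕ),
        (∀ i, (ρ i ∈ 𝒜 ∧ p i = 0) ∨ IsScalarNet 𝒜 h (ρ i) (p i)) ∧
        IsFeedforward (Set.range ρ) 1 1 F k ∧
        (∀ x, φ x = F (fun _ => x) 0) ∧ n = k + ∑ i, p i

/-- Univariate Lipschitz functions on `[0, 1]` are approximated to accuracy `L ε` in `L²([0, 1])` by
networks with `O(ε^{-β} (1 + |log ε|)^κ)` parameters, uniformly in the function, in its Lipschitz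
constant `L`, and in `ε ∈ (0, 1]`. -/
def SurrogateProperty (𝒜 : Set (ℝ → ℝ)) (h : ℕ) (β κ : ℝ) : Prop :=
  ∃ K : ℝ, 0 < K ∧ ∀ (L : ℝ≥0) (f : ℝ → ℝ), 0 < L → LipschitzOnWith L f (Icc 0 1) →
    ∀ ε ∈ Ioc (0 : ℝ) 1, ∃ (φ : ℝ → ℝ) (n : ℕ), IsScalarNet 𝒜 h φ n ∧
      (n : ℝ) ≤ K * ε ^ (-β) * (1 + |Real.log ε|) ^ κ ∧
      eLpNorm (fun x => f x - φ x) 2 (volume.restrict (Icc (0 : ℝ) 1)) ≤ ENNReal.ofReal (L * ε)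

end Networks

end

/-!
With the Hilbert-Schmidt inner product, `S₂` is a Hilbert space in which pairing with the dyad
`w ⊗ v` gives the matrix coefficient `⟪w, A v⟫` (`inner_dyad`). Hence dyads of orthonormal families
are orthonormal, and diagonal series with square summable coefficients converge in `S₂`. A singular
value decomposition of `A` comes from an orthonormal basis of eigenvectors `eᵢ` of the compact
operator `A⋆A`, for which the vectors `A eᵢ` are orthogonal (`exists_isSVD`).

Let `A = ∑ aⱼ Dⱼ` and `B = ∑ bₖ D'ₖ` be two such decompositions and `αⱼₖ = Re ⟪Dⱼ, D'ₖ⟫`. By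
Cauchy-Schwarz and Bessel, `|αⱼₖ|` is majorised by a matrix `mⱼₖ` whose rows and columns sum to at
most `1`. So `‖∑ f(aⱼ) Dⱼ - ∑ f(bₖ) D'ₖ‖²` is a combination with nonnegative coefficients of
`f(aⱼ)²`, `f(bₖ)²`, `(f(aⱼ) - f(bₖ))²` and `(f(aⱼ) + f(bₖ))²`. Each of these is at most `L²` times
the same expression with `f` removed, because `f` is Lipschitz and `f(0) = 0`
(`quadratic_form_le_of_substochastic`). This gives the Lipschitz bound with the constant of `f`, and
for `A = B` the independence of the decomposition (`IsSVD.norm_sub_le`).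

On the cube, the operator `σ(u)` is diagonal with singular values `r ωⱼˢ |uⱼ|`, so the squared error
of a network is at most the sum of the squared scalar errors at the retained singular values and
`(L r)² ∑_{j ≥ N} ωⱼ^{2s}` (`norm_sq_svCalc_sub_svNetwork_le`). Under the product measure `|uⱼ|` is
uniform on `[0, 1]`, and scalar surrogates on `[0, 1]` are rescaled through their first layer at no
cost. The number `N` of retained values is the least one for which the tail is of order `ε²`. This
choice does not depend on the exponent, and minimality together with `ω ∈ ℓ^{1+η}` bounds both the
last retained weight from below and `N` from above, by powers of `ε` arbitrarily close to the
critical ones (`exists_truncation`, `truncation_level_le`). Individual surrogates may all have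
accuracy of order `ε`. A common surrogate loses the density `(ω₀ / ωⱼ)ˢ` of the `j`-th singular
value on the common interval, which is compensated by a higher accuracy.
-/

/-! ### The Hilbert space of Hilbert-Schmidt operators -/

section OrthogonalSeries

variable {𝕜 : Type*} [RCLike 𝕜]
variable {E : Type*} [NormedAddCommGroup E] [InnerProductSpace 𝕜 E] {ι : Type*} {x : ι → E}

theorem orthogonalFamily_span_singleton (h : Pairwise fun i j => ⟪x i, x j⟫_𝕜 = 0) :
    OrthogonalFamily 𝕜 (fun i => Submodule.span 𝕜 {x i})
      fun i => (Submodule.span 𝕜 {x i}).subtypeₗᵢ := by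
  rintro i j hij ⟨y, hy⟩ ⟨z, hz⟩
  obtain ⟨c, rfl⟩ := Submodule.mem_span_singleton.1 hy
  obtain ⟨d, rfl⟩ := Submodule.mem_span_singleton.1 hz
  simp [inner_smul_left, inner_smul_right, h hij]

theorem summable_of_pairwise_orthogonal [CompleteSpace E]
    (h : Pairwise fun i j => ⟪x i, x j⟫_𝕜 = 0) (hx : Summable fun i => ‖x i‖ ^ 2) : Summable x :=
  ((orthogonalFamily_span_singleton h).summable_iff_norm_sq_summable
    fun i => ⟨x i, Submodule.mem_span_singleton_self (x i)⟩).2 hx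

theorem hasSum_norm_sq_of_pairwise_orthogonal (h : Pairwise fun i j => ⟪x i, x j⟫_𝕜 = 0) {y : E}
    (hx : HasSum x y) : HasSum (fun i => ‖x i‖ ^ 2) (‖y‖ ^ 2) := by
  refine (hx.norm.pow 2).congr fun s => ?_
  exact (orthogonalFamily_span_singleton h).norm_sum
    (fun i => ⟨x i, Submodule.mem_span_singleton_self (x i)⟩) s

end OrthogonalSeries

section HilbertSpace

variable {𝕜 : Type*} [RCLike 𝕜]
variable {H₁ : Type*} [NormedAddCommGroup H₁] [InnerProductSpace 𝕜 H₁] [CompleteSpace H₁]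
variable {H₂ : Type*} [NormedAddCommGroup H₂] [InnerProductSpace 𝕜 H₂]

theorem HS.norm_eq (A : HS 𝕜 H₁ H₂) : ‖A‖ = ‖hsCoord 𝕜 H₁ H₂ A‖ := rfl

/-- The Hilbert-Schmidt inner product `∑ᵢ ⟪A bᵢ, B bᵢ⟫`, pulled back from `ℓ²` along `hsCoord`; it
induces the Hilbert-Schmidt norm. -/
noncomputable instance : InnerProductSpace 𝕜 (HS 𝕜 H₁ H₂) where
  inner A B := ⟪hsCoord 𝕜 H₁ H₂ A, hsCoord 𝕜 H₁ H₂ B⟫_𝕜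
  norm_sq_eq_re_inner A := by
    rw [HS.norm_eq]; exact norm_sq_eq_re_inner (𝕜 := 𝕜) (hsCoord 𝕜 H₁ H₂ A)
  conj_inner_symm A B := inner_conj_symm (hsCoord 𝕜 H₁ H₂ A) (hsCoord 𝕜 H₁ H₂ B)
  add_left A B C := by rw [map_add, inner_add_left]
  smul_left A B c := by rw [map_smul, inner_smul_left]

theorem HS.inner_eq (A B : HS 𝕜 H₁ H₂) :
    ⟪A, B⟫_𝕜 = ⟪hsCoord 𝕜 H₁ H₂ A, hsCoord 𝕜 H₁ H₂ B⟫_𝕜 := rfl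

theorem dyad_op_apply (w : H₂) (v x : H₁) :
    (dyad w v : HS 𝕜 H₁ H₂).op x = ⟪v, x⟫_𝕜 • w := rfl

theorem dyad_smul_left (c : 𝕜) (w : H₂) (v : H₁) :
    (dyad (c • w) v : HS 𝕜 H₁ H₂) = c • dyad w v := by
  apply Subtype.ext
  change InnerProductSpace.rankOne 𝕜 (c • w) v = c • InnerProductSpace.rankOne 𝕜 w v
  simp

theorem HS.op_injective : Function.Injective (HS.op : HS 𝕜 H₁ H₂ → (H₁ →L[𝕜] H₂)) :=
  Subtype.val_injective

variable [CompleteSpace H₂]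

/-- Pairing with a dyad in `S₂` evaluates a matrix coefficient. -/
theorem inner_dyad (w : H₂) (v : H₁) (A : HS 𝕜 H₁ H₂) : ⟪dyad w v, A⟫_𝕜 = ⟪w, A.op v⟫_𝕜 := by
  rw [HS.inner_eq, lp.inner_eq_tsum]
  have h := (refBasis 𝕜 H₁).tsum_inner_mul_inner ((ContinuousLinearMap.adjoint A.op) w) v
  rw [ContinuousLinearMap.adjoint_inner_left] at h
  rw [← h]
  refine tsum_congr fun i => ?_
  change ⟪(dyad w v : HS 𝕜 H₁ H₂).op _, A.op _⟫_𝕜 = _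
  rw [dyad_op_apply, inner_smul_left, inner_conj_symm, ContinuousLinearMap.adjoint_inner_left,
    mul_comm]

theorem inner_dyad_dyad (w w' : H₂) (v v' : H₁) :
    ⟪(dyad w v : HS 𝕜 H₁ H₂), dyad w' v'⟫_𝕜 = ⟪v', v⟫_𝕜 * ⟪w, w'⟫_𝕜 := by
  rw [inner_dyad, dyad_op_apply, inner_smul_right]

theorem norm_dyad (w : H₂) (v : H₁) : ‖(dyad w v : HS 𝕜 H₁ H₂)‖ = ‖w‖ * ‖v‖ := by
  have h : ‖(dyad w v : HS 𝕜 H₁ H₂)‖ ^ 2 = (‖w‖ * ‖v‖) ^ 2 := by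
    rw [norm_sq_eq_re_inner (𝕜 := 𝕜), inner_dyad_dyad, inner_self_eq_norm_sq_to_K,
      inner_self_eq_norm_sq_to_K]
    norm_cast
    ring
  exact (pow_left_inj₀ (norm_nonneg _) (by positivity) two_ne_zero).1 h

theorem HS.norm_op_apply_le (A : HS 𝕜 H₁ H₂) (x : H₁) : ‖A.op x‖ ≤ ‖A‖ * ‖x‖ := by
  rcases eq_or_ne (A.op x) 0 with h0 | h0
  · rw [h0, norm_zero]; positivity
  have h := norm_inner_le_norm (𝕜 := 𝕜) (dyad (A.op x) x) A
  rw [inner_dyad, norm_dyad, inner_self_eq_norm_sq_to_K] at h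
  simp only [norm_pow, RCLike.norm_ofReal, abs_norm] at h
  have := norm_pos_iff.2 h0
  nlinarith

variable (𝕜 H₁ H₂) in
/-- The contractive inclusion of `S₂` into the bounded operators. -/
noncomputable def HS.opL : HS 𝕜 H₁ H₂ →L[𝕜] (H₁ →L[𝕜] H₂) :=
  LinearMap.mkContinuous (hsSubmodule 𝕜 H₁ H₂).subtype 1 fun A => by
    rw [one_mul]
    exact ContinuousLinearMap.opNorm_le_bound _ (norm_nonneg _) A.norm_op_apply_le

theorem HS.opL_apply (A : HS 𝕜 H₁ H₂) : HS.opL 𝕜 H₁ H₂ A = A.op := rfl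

instance : CompleteSpace (HS 𝕜 H₁ H₂) := by
  have hiso : Isometry (hsCoord 𝕜 H₁ H₂) := AddMonoidHomClass.isometry_of_norm _ fun _ => rfl
  refine Metric.complete_of_cauchySeq_tendsto fun A hA => ?_
  -- the limit exists in operator norm and coordinatewise in `ℓ²`; the two limits agree
  have hA₁ : CauchySeq fun n => HS.opL 𝕜 H₁ H₂ (A n) :=
    hA.map (HS.opL 𝕜 H₁ H₂).uniformContinuous
  have hA₂ : CauchySeq fun n => hsCoord 𝕜 H₁ H₂ (A n) := hA.map hiso.uniformContinuous
  obtain ⟨T, hT⟩ := cauchySeq_tendsto_of_complete hA₁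
  obtain ⟨y, hy⟩ := cauchySeq_tendsto_of_complete hA₂
  have hcoord : ∀ i, y i = T (refBasis 𝕜 H₁ i) := by
    intro i
    refine tendsto_nhds_unique (f := fun n => (A n).op (refBasis 𝕜 H₁ i))
      (l := Filter.atTop) ?_ ?_
    · refine tendsto_iff_norm_sub_tendsto_zero.2
        (squeeze_zero (fun _ => norm_nonneg _) (fun n => ?_)
          (tendsto_iff_norm_sub_tendsto_zero.1 hy))
      exact lp.norm_apply_le_norm two_ne_zero (hsCoord 𝕜 H₁ H₂ (A n) - y) i
    · exact ((ContinuousLinearMap.apply 𝕜 H₂ (refBasis 𝕜 H₁ i)).continuous.tendsto T).comp hT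
  have hmem : T ∈ hsSubmodule 𝕜 H₁ H₂ := by
    change Memℓp (fun i => T (refBasis 𝕜 H₁ i)) 2
    have : (fun i => T (refBasis 𝕜 H₁ i)) = fun i => y i := funext fun i => (hcoord i).symm
    rw [this]
    exact y.2
  refine ⟨⟨T, hmem⟩, (hiso.isEmbedding.isInducing.tendsto_nhds_iff).2 ?_⟩
  have : hsCoord 𝕜 H₁ H₂ ⟨T, hmem⟩ = y := by
    ext i
    exact (hcoord i).symm
  rw [this]
  exact hy

/-- Dyads of orthonormal families are orthonormal in `S₂`. -/
theorem orthonormal_dyad {ι : Type*} {v : ι → H₁} {w : ι → H₂} (hv : Orthonormal 𝕜 v)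
    (hw : Orthonormal 𝕜 w) : Orthonormal 𝕜 fun i => (dyad (w i) (v i) : HS 𝕜 H₁ H₂) := by
  refine ⟨fun i => ?_, fun i j hij => ?_⟩
  · rw [norm_dyad, hv.1, hw.1, one_mul]
  · change ⟪(dyad (w i) (v i) : HS 𝕜 H₁ H₂), dyad (w j) (v j)⟫_𝕜 = 0
    rw [inner_dyad_dyad, hw.2 hij, mul_zero]

theorem HS.summable_norm_sq {ι : Type*} (e : HilbertBasis ι 𝕜 H₁) (A : HS 𝕜 H₁ H₂) :
    Summable fun i => ‖A.op (e i)‖ ^ 2 := by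
  have hA : Summable fun i => ‖A.op (refBasis 𝕜 H₁ i)‖ ^ 2 := by
    have := (lp.memℓp (hsCoord 𝕜 H₁ H₂ A)).summable (by norm_num)
    simp only [ENNReal.toReal_ofNat, Real.rpow_ofNat] at this
    exact this
  have h := hs_sum_eq_of_bases e (refBasis 𝕜 H₁) A.op
  rw [tsum_congr fun i => by rw [← ofReal_norm, ← ENNReal.ofReal_pow (norm_nonneg _)],
    tsum_congr (f := fun i => ‖A.op (refBasis 𝕜 H₁ i)‖ₑ ^ 2)
      fun i => by rw [← ofReal_norm, ← ENNReal.ofReal_pow (norm_nonneg _)],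
    ← ENNReal.ofReal_tsum_of_nonneg (fun _ => by positivity) hA] at h
  refine (ENNReal.summable_toReal (h.trans_ne ENNReal.ofReal_ne_top)).congr fun i => ?_
  exact ENNReal.toReal_ofReal (by positivity)

/-- Every Hilbert-Schmidt operator is the sum in `S₂` of the dyads `A eᵢ ⊗ eᵢ` along any Hilbert
basis `e`. -/
theorem HS.hasSum_dyad_basis {ι : Type*} (e : HilbertBasis ι 𝕜 H₁) (A : HS 𝕜 H₁ H₂) :
    HasSum (fun i => (dyad (A.op (e i)) (e i) : HS 𝕜 H₁ H₂)) A := by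
  have horth : Pairwise fun i j =>
      ⟪(dyad (A.op (e i)) (e i) : HS 𝕜 H₁ H₂), dyad (A.op (e j)) (e j)⟫_𝕜 = 0 := by
    intro i j hij
    simp only [inner_dyad_dyad, e.orthonormal.2 hij.symm, zero_mul]
  obtain ⟨B, hB⟩ := summable_of_pairwise_orthogonal horth
    ((A.summable_norm_sq e).congr fun i => by rw [norm_dyad, e.orthonormal.1, mul_one])
  have hBA : ∀ j, B.op (e j) = A.op (e j) := by
    intro j
    have h1 := hB.mapL ((ContinuousLinearMap.apply 𝕜 H₂ (e j)).comp (HS.opL 𝕜 H₁ H₂))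
    refine h1.unique ?_
    have h2 := hasSum_single (f := fun i => (dyad (A.op (e i)) (e i) : HS 𝕜 H₁ H₂).op (e j)) j
      fun i hij => by rw [dyad_op_apply, e.orthonormal.2 hij, zero_smul]
    have h3 : (dyad (A.op (e j)) (e j) : HS 𝕜 H₁ H₂).op (e j) = A.op (e j) := by
      rw [dyad_op_apply, inner_self_eq_norm_sq_to_K, e.orthonormal.1]
      simp
    rw [h3] at h2
    exact h2
  have : B = A := by
    apply HS.op_injective
    refine ContinuousLinearMap.ext_on
      (Submodule.dense_iff_topologicalClosure_eq_top.mpr e.dense_span) ?_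
    rintro _ ⟨i, rfl⟩
    exact hBA i
  rwa [this] at hB

/-- Hilbert-Schmidt operators are compact: the expansion along a basis is an operator norm limit
of finite rank operators. -/
theorem HS.isCompactOperator (A : HS 𝕜 H₁ H₂) : IsCompactOperator A.op := by
  have h := (A.hasSum_dyad_basis (refBasis 𝕜 H₁)).mapL (HS.opL 𝕜 H₁ H₂)
  have hmem : ∀ t : Finset (refIndex 𝕜 H₁), ∑ i ∈ t, HS.opL 𝕜 H₁ H₂
      (dyad (A.op (refBasis 𝕜 H₁ i)) (refBasis 𝕜 H₁ i)) ∈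
        compactOperator (RingHom.id 𝕜) H₁ H₂ := fun t =>
    Submodule.sum_mem _ fun i _ =>
      (isCompactOperator_of_locallyCompactSpace_dom
        (innerSL 𝕜 (refBasis 𝕜 H₁ i))).clm_comp
          (ContinuousLinearMap.toSpanSingleton 𝕜 (A.op (refBasis 𝕜 H₁ i)))
  exact isCompactOperator_of_tendsto h (Filter.Eventually.of_forall hmem)

end HilbertSpace

/-! ### Singular value decompositions -/

section SVD

variable {𝕜 : Type*} [RCLike 𝕜]

/-- Hilbert bases of pairwise orthogonal closed subspaces whose span is dense combine to a Hilbert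
basis of the whole space. -/
theorem exists_hilbertBasis_of_orthogonalFamily.{u, u'} {κ : Type u'} {E : Type u}
    [NormedAddCommGroup E] [InnerProductSpace 𝕜 E] [CompleteSpace E] (V : κ → Submodule 𝕜 E)
    [∀ k, CompleteSpace (V k)]
    (hV : OrthogonalFamily 𝕜 (fun k => V k) fun k => (V k).subtypeₗᵢ) (hbot : (⨆ k, V k)ᗮ = ⊥) :
    ∃ (ι : Type (max u' u)) (e : HilbertBasis ι 𝕜 E), ∀ i, ∃ k, e i ∈ V k := by
  let v : (Σ k, refIndex 𝕜 (V k)) → E := fun p => (refBasis 𝕜 (V p.1) p.2 : E)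
  have hv : Orthonormal 𝕜 v :=
    hV.orthonormal_sigma_orthonormal fun k => (refBasis 𝕜 (V k)).orthonormal
  have hv_bot : (Submodule.span 𝕜 (Set.range v))ᗮ = ⊥ := by
    rw [eq_bot_iff, ← hbot, ← Submodule.iInf_orthogonal]
    intro x hx
    refine (Submodule.mem_iInf _).2 fun k => (Submodule.mem_orthogonal _ _).2 fun y hy => ?_
    have h1 := ((refBasis 𝕜 (V k)).hasSum_repr ⟨y, hy⟩).mapL
      ((innerSL 𝕜 x).comp (V k).subtypeL)
    have h2 : ⟪x, y⟫_𝕜 = 0 := by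
      refine h1.unique ?_
      convert hasSum_zero using 2 with i
      have h3 : ⟪x, v ⟨k, i⟩⟫_𝕜 = 0 :=
        Submodule.inner_left_of_mem_orthogonal (Submodule.subset_span (Set.mem_range_self _)) hx
      rw [map_smul]
      exact smul_eq_zero_of_right _ h3
    rw [← inner_conj_symm, h2, map_zero]
  refine ⟨_, HilbertBasis.mkOfOrthogonalEqBot hv hv_bot, fun p => ⟨p.1, ?_⟩⟩
  rw [HilbertBasis.coe_mkOfOrthogonalEqBot]
  exact (refBasis 𝕜 (V p.1) p.2).2

theorem exists_hilbertBasis_eigenvectors.{u, u'} {𝕜 : Type u'} [RCLike 𝕜] {E : Type u}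
    [NormedAddCommGroup E] [InnerProductSpace 𝕜 E] [CompleteSpace E] {T : E →L[𝕜] E}
    (hT : IsCompactOperator T) (hT' : T.IsSymmetric) :
    ∃ (ι : Type (max u' u)) (e : HilbertBasis ι 𝕜 E), ∀ i, ∃ μ : 𝕜, T (e i) = μ • e i := by
  have hVc : ∀ μ, IsClosed (Module.End.eigenspace (T : Module.End 𝕜 E) μ : Set E) := fun μ => by
    have : (Module.End.eigenspace (T : Module.End 𝕜 E) μ : Set E) = {x | T x = μ • x} := by
      ext x
      exact Module.End.mem_eigenspace_iff
    rw [this]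
    exact isClosed_eq T.continuous (continuous_const_smul μ)
  have hVcomp : ∀ μ, CompleteSpace (Module.End.eigenspace (T : Module.End 𝕜 E) μ) :=
    fun μ => (hVc μ).completeSpace_coe
  obtain ⟨ι, e, he⟩ := exists_hilbertBasis_of_orthogonalFamily
    (fun μ => Module.End.eigenspace (T : Module.End 𝕜 E) μ) hT'.orthogonalFamily_eigenspaces
    (ContinuousLinearMap.orthogonalComplement_iSup_eigenspaces_eq_bot hT hT')
  refine ⟨ι, e, fun i => ?_⟩
  obtain ⟨μ, hμ⟩ := he i
  exact ⟨μ, Module.End.mem_eigenspace_iff.1 hμ⟩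

variable {H₁ : Type*} [NormedAddCommGroup H₁] [InnerProductSpace 𝕜 H₁] [CompleteSpace H₁]
variable {H₂ : Type*} [NormedAddCommGroup H₂] [InnerProductSpace 𝕜 H₂] [CompleteSpace H₂]

/-- An orthonormal basis of eigenvectors `eᵢ` of `A⋆A` makes the vectors `A eᵢ` orthogonal, so that
`A = ∑ A eᵢ ⊗ eᵢ` is a singular value decomposition after normalisation. -/
theorem exists_isSVD (A : HS 𝕜 H₁ H₂) : ∃ a v w, IsSVD A a v w := by
  have hcomp : IsCompactOperator (ContinuousLinearMap.adjoint A.op ∘L A.op) :=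
    A.isCompactOperator.clm_comp (ContinuousLinearMap.adjoint A.op)
  obtain ⟨ι, e, he⟩ := exists_hilbertBasis_eigenvectors hcomp
    (ContinuousLinearMap.isPositive_adjoint_comp_self A.op).isSymmetric
  have horth : ∀ i j, i ≠ j → ⟪A.op (e i), A.op (e j)⟫_𝕜 = 0 := by
    intro i j hij
    obtain ⟨μ, hμ⟩ := he i
    rw [← ContinuousLinearMap.adjoint_inner_left]
    change ⟪(ContinuousLinearMap.adjoint A.op ∘L A.op) (e i), e j⟫_𝕜 = 0
    rw [hμ, inner_smul_left, e.orthonormal.2 hij, mul_zero]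
  let J : Set ι := {i | A.op (e i) ≠ 0}
  have hJ : J.Countable := by
    refine (A.summable_norm_sq e).countable_support.mono fun i hi => ?_
    have : A.op (e i) ≠ 0 := hi
    simpa using this
  have : Countable J := hJ
  let _ : Encodable J := Encodable.ofCountable J
  let enc : J → ℕ := Encodable.encode
  have henc : Function.Injective enc := Encodable.encode_injective
  let w₀ : J → H₂ := fun i => ((‖A.op (e i)‖⁻¹ : ℝ) : 𝕜) • A.op (e i)
  have hw₀ : Orthonormal 𝕜 w₀ := by
    refine ⟨fun i => ?_, fun i j hij => ?_⟩
    · have : ‖A.op (e i)‖ ≠ 0 := norm_ne_zero_iff.2 i.2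
      simp [w₀, norm_smul, this]
    · have h0 := horth i j fun h => hij (Subtype.ext h)
      change ⟪((‖A.op (e i)‖⁻¹ : ℝ) : 𝕜) • A.op (e i),
        ((‖A.op (e j)‖⁻¹ : ℝ) : 𝕜) • A.op (e j)⟫_𝕜 = 0
      rw [inner_smul_left, inner_smul_right, h0, mul_zero, mul_zero]
  let a : ℕ → ℝ≥0 := Function.extend enc (fun i => ‖A.op (e i)‖₊) 0
  let v : ℕ → H₁ := Function.extend enc (fun i => e i) 0
  let w : ℕ → H₂ := Function.extend enc w₀ 0
  have hex : ∀ j : {j // a j ≠ 0}, ∃ i, enc i = j := by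
    rintro ⟨j, hj⟩
    by_contra hn
    exact hj (Function.extend_apply' _ _ _ hn)
  choose g hg using hex
  have hginj : Function.Injective g := fun j k hjk => Subtype.ext (by rw [← hg j, ← hg k, hjk])
  refine ⟨a, v, w, ?_, ?_, ?_⟩
  · convert e.orthonormal.comp (fun j => (g j : ι))
      (Subtype.val_injective.comp hginj) using 1
    funext j
    simp only [v, Function.comp_apply]
    rw [← hg j, henc.extend_apply]
  · convert hw₀.comp g hginj using 1
    funext j
    simp only [w, Function.comp_apply]
    rw [← hg j, henc.extend_apply]
  · have h1 := (A.hasSum_dyad_basis e).mapL (HS.opL 𝕜 H₁ H₂)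
    have h2 : HasSum (fun i : J => HS.opL 𝕜 H₁ H₂ (dyad (A.op (e i)) (e i))) A.op := by
      refine (hasSum_subtype_iff_of_support_subset (f := fun i =>
        HS.opL 𝕜 H₁ H₂ (dyad (A.op (e i)) (e i))) (s := J) fun i hi hz => hi ?_).2 h1
      ext x
      change (dyad (A.op (e i)) (e i) : HS 𝕜 H₁ H₂).op x = 0
      rw [dyad_op_apply, hz, smul_zero]
    rw [← hasSum_extend_zero henc] at h2
    convert h2 using 1
    funext j
    by_cases hj : ∃ i, enc i = j
    · obtain ⟨i, rfl⟩ := hj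
      simp only [a, v, w, henc.extend_apply]
      have hi : ‖A.op (e i)‖ ≠ 0 := norm_ne_zero_iff.2 i.2
      ext x
      rw [smul_apply, HS.opL_apply]
      rw [dyad_op_apply, dyad_op_apply, smul_comm]
      simp only [w₀, smul_smul, coe_nnnorm]
      rw [← RCLike.ofReal_mul, mul_inv_cancel₀ hi]
      simp
    · rw [Function.extend_apply' _ _ _ hj]
      simp only [a]
      rw [Function.extend_apply' _ _ _ hj]
      simp

end SVD

/-! ### The singular value functional calculus -/

/-- The inequality behind the sharp Lipschitz constant. Here `α i k` stands for the real part of the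
inner product of the dyads with indices `i` and `k`, and `m` is a substochastic majorant of `|α|`.
Spreading `xᵢ²` and `yₖ²` over `m` reduces the claim to the terms
`m (x² + y²) - 2 α x y = (m + α) / 2 * (x - y)² + (m - α) / 2 * (x + y)²`. -/
theorem quadratic_form_le_of_substochastic {ι κ : Type*} (t : Finset ι) (u : Finset κ)
    (a x : ι → ℝ) (b y : κ → ℝ) (m α : ι → κ → ℝ) (L : ℝ)
    (hα : ∀ i k, |α i k| ≤ m i k) (hm₁ : ∀ i, ∑ k ∈ u, m i k ≤ 1)
    (hm₂ : ∀ k, ∑ i ∈ t, m i k ≤ 1) (hx : ∀ i, x i ^ 2 ≤ L ^ 2 * a i ^ 2)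
    (hy : ∀ k, y k ^ 2 ≤ L ^ 2 * b k ^ 2)
    (hsub : ∀ i k, (x i - y k) ^ 2 ≤ L ^ 2 * (a i - b k) ^ 2)
    (hadd : ∀ i k, (x i + y k) ^ 2 ≤ L ^ 2 * (a i + b k) ^ 2) :
    ∑ i ∈ t, x i ^ 2 + ∑ k ∈ u, y k ^ 2 - 2 * ∑ i ∈ t, ∑ k ∈ u, x i * y k * α i k ≤
      L ^ 2 * (∑ i ∈ t, a i ^ 2 + ∑ k ∈ u, b k ^ 2 -
        2 * ∑ i ∈ t, ∑ k ∈ u, a i * b k * α i k) := by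
  have key : ∀ (p : ι → ℝ) (q : κ → ℝ),
      ∑ i ∈ t, p i ^ 2 + ∑ k ∈ u, q k ^ 2 - 2 * ∑ i ∈ t, ∑ k ∈ u, p i * q k * α i k =
        ∑ i ∈ t, p i ^ 2 * (1 - ∑ k ∈ u, m i k) + ∑ k ∈ u, q k ^ 2 * (1 - ∑ i ∈ t, m i k) +
          ∑ i ∈ t, ∑ k ∈ u, (m i k * (p i ^ 2 + q k ^ 2) - 2 * (p i * q k * α i k)) := by
    intro p q
    simp only [mul_sub, mul_one, mul_add, Finset.sum_sub_distrib, Finset.sum_add_distrib,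
      Finset.mul_sum]
    rw [Finset.sum_comm (s := u) (t := t)]
    simp only [mul_comm (m _ _)]
    ring
  rw [key, key, mul_add, mul_add, Finset.mul_sum, Finset.mul_sum, Finset.mul_sum]
  refine add_le_add (add_le_add (Finset.sum_le_sum fun i _ => ?_)
    (Finset.sum_le_sum fun k _ => ?_)) (Finset.sum_le_sum fun i _ => ?_)
  · rw [← mul_assoc]
    exact mul_le_mul_of_nonneg_right (hx i) (sub_nonneg.2 (hm₁ i))
  · rw [← mul_assoc]
    exact mul_le_mul_of_nonneg_right (hy k) (sub_nonneg.2 (hm₂ k))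
  · rw [Finset.mul_sum]
    refine Finset.sum_le_sum fun k _ => ?_
    have h1 := mul_le_mul_of_nonneg_left (hsub i k)
      (show 0 ≤ m i k + α i k by linarith [neg_le_of_abs_le (hα i k)])
    have h2 := mul_le_mul_of_nonneg_left (hadd i k)
      (show 0 ≤ m i k - α i k by linarith [le_of_abs_le (hα i k)])
    linarith

section Calculus

theorem abs_le_of_lipschitzWith {f : ℝ≥0 → ℝ} {L : ℝ≥0} (hf : LipschitzWith L f) (hf0 : f 0 = 0)
    (x : ℝ≥0) : |f x| ≤ L * x := by
  have := hf.dist_le_mul x 0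
  rwa [Real.dist_eq, NNReal.dist_eq, hf0, sub_zero, NNReal.coe_zero, sub_zero, NNReal.abs_eq]
    at this

variable {𝕜 : Type*} [RCLike 𝕜]
variable {H₁ : Type*} [NormedAddCommGroup H₁] [InnerProductSpace 𝕜 H₁] [CompleteSpace H₁]
variable {H₂ : Type*} [NormedAddCommGroup H₂] [InnerProductSpace 𝕜 H₂]

theorem IsSVD.op_apply {A : HS 𝕜 H₁ H₂} {a : ℕ → ℝ≥0} {v : ℕ → H₁} {w : ℕ → H₂}
    (h : IsSVD A a v w) {j : ℕ} (hj : a j ≠ 0) : A.op (v j) = ((a j : ℝ) : 𝕜) • w j := by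
  have h1 := h.hasSum.mapL (ContinuousLinearMap.apply 𝕜 H₂ (v j))
  refine h1.unique ?_
  have h2 := hasSum_single (f := fun k => ((a k : ℝ) : 𝕜) •
    (dyad (w k) (v k) : HS 𝕜 H₁ H₂).op (v j)) j fun k hkj => by
      by_cases hk : a k = 0
      · simp [hk]
      · rw [dyad_op_apply, h.right_orthonormal.2 (i := ⟨k, hk⟩) (j := ⟨j, hj⟩)
          fun h => hkj (congrArg Subtype.val h), zero_smul, smul_zero]
  have h3 : (dyad (w j) (v j) : HS 𝕜 H₁ H₂).op (v j) = w j := by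
    rw [dyad_op_apply, inner_self_eq_norm_sq_to_K, h.right_orthonormal.1 ⟨j, hj⟩]
    simp
  rw [h3] at h2
  exact h2

variable [CompleteSpace H₂]

theorem Orthonormal.norm_sq_sum_ofReal_smul {E : Type*} [NormedAddCommGroup E]
    [InnerProductSpace 𝕜 E] {ι : Type*} {D : ι → E} (hD : Orthonormal 𝕜 D) (x : ι → ℝ)
    (t : Finset ι) : ‖∑ i ∈ t, (x i : 𝕜) • D i‖ ^ 2 = ∑ i ∈ t, x i ^ 2 := by
  rw [norm_sq_eq_re_inner (𝕜 := 𝕜), hD.inner_sum, map_sum]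
  refine Finset.sum_congr rfl fun i _ => ?_
  rw [RCLike.conj_ofReal, RCLike.re_ofReal_mul, RCLike.ofReal_re, sq]

theorem norm_sq_sum_sub_sum {E : Type*} [NormedAddCommGroup E] [InnerProductSpace 𝕜 E]
    {ι κ : Type*} {D : ι → E} {D' : κ → E} (hD : Orthonormal 𝕜 D) (hD' : Orthonormal 𝕜 D')
    (t : Finset ι) (u : Finset κ) (x : ι → ℝ) (y : κ → ℝ) :
    ‖∑ i ∈ t, (x i : 𝕜) • D i - ∑ k ∈ u, (y k : 𝕜) • D' k‖ ^ 2 =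
      ∑ i ∈ t, x i ^ 2 + ∑ k ∈ u, y k ^ 2 -
        2 * ∑ i ∈ t, ∑ k ∈ u, x i * y k * RCLike.re ⟪D i, D' k⟫_𝕜 := by
  rw [@norm_sub_sq 𝕜, hD.norm_sq_sum_ofReal_smul, hD'.norm_sq_sum_ofReal_smul, sum_inner, map_sum]
  simp only [inner_sum, map_sum, inner_smul_left, inner_smul_right, RCLike.conj_ofReal,
    RCLike.re_ofReal_mul]
  rw [add_sub_right_comm]
  simp only [mul_assoc, mul_left_comm (y _)]

variable {f : ℝ≥0 → ℝ} {L : ℝ≥0}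

/-- The Lipschitz estimate for finite sums of dyads. The inner product of the dyads `wᵢ ⊗ vᵢ` and
`w'ₖ ⊗ v'ₖ` is `⟪v'ₖ, vᵢ⟫ ⟪wᵢ, w'ₖ⟫`; the mean of the squared moduli of the two factors majorises
it and is substochastic by Bessel's inequality. -/
theorem norm_sub_le_of_lipschitz_svd {ι κ : Type*} {v : ι → H₁} {w : ι → H₂} {v' : κ → H₁}
    {w' : κ → H₂} (hf : LipschitzWith L f) (hf0 : f 0 = 0) (hv : Orthonormal 𝕜 v)
    (hw : Orthonormal 𝕜 w) (hv' : Orthonormal 𝕜 v') (hw' : Orthonormal 𝕜 w')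
    (a : ι → ℝ≥0) (b : κ → ℝ≥0) (t : Finset ι) (u : Finset κ) :
    ‖∑ i ∈ t, ((f (a i) : ℝ) : 𝕜) • (dyad (w i) (v i) : HS 𝕜 H₁ H₂) -
      ∑ k ∈ u, ((f (b k) : ℝ) : 𝕜) • dyad (w' k) (v' k)‖ ≤
    L * ‖∑ i ∈ t, ((a i : ℝ) : 𝕜) • (dyad (w i) (v i) : HS 𝕜 H₁ H₂) -
      ∑ k ∈ u, ((b k : ℝ) : 𝕜) • dyad (w' k) (v' k)‖ := by
  have hfL : ∀ x y, |f x - f y| ≤ L * |(x : ℝ) - y| := fun x y => by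
    have := hf.dist_le_mul x y
    rwa [Real.dist_eq, NNReal.dist_eq] at this
  have hf1 := abs_le_of_lipschitzWith hf hf0
  have hsq : ∀ {p q : ℝ}, |p| ≤ L * |q| → p ^ 2 ≤ (L : ℝ) ^ 2 * q ^ 2 := fun {p q} h => by
    rw [← sq_abs p, ← sq_abs q, ← mul_pow]
    exact pow_le_pow_left₀ (abs_nonneg _) h 2
  refine le_of_sq_le_sq ?_ (by positivity)
  rw [mul_pow, norm_sq_sum_sub_sum (orthonormal_dyad hv hw) (orthonormal_dyad hv' hw'),
    norm_sq_sum_sub_sum (orthonormal_dyad hv hw) (orthonormal_dyad hv' hw')]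
  refine quadratic_form_le_of_substochastic t u (fun i => (a i : ℝ)) (fun i => f (a i))
    (fun k => (b k : ℝ)) (fun k => f (b k))
    (fun i k => (‖⟪v' k, v i⟫_𝕜‖ ^ 2 + ‖⟪w i, w' k⟫_𝕜‖ ^ 2) / 2) _ L ?_ ?_ ?_ ?_ ?_ ?_ ?_
  · intro i k
    refine (RCLike.abs_re_le_norm _).trans ?_
    rw [inner_dyad_dyad, norm_mul]
    nlinarith [sq_nonneg (‖⟪v' k, v i⟫_𝕜‖ - ‖⟪w i, w' k⟫_𝕜‖)]
  · intro i
    have h1 := hv'.sum_inner_products_le (v i) (s := u)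
    have h2 := hw'.sum_inner_products_le (w i) (s := u)
    rw [hv.1, one_pow] at h1
    rw [hw.1, one_pow] at h2
    simp only [norm_inner_symm (w i)]
    rw [← Finset.sum_div, Finset.sum_add_distrib]
    linarith
  · intro k
    have h1 := hv.sum_inner_products_le (v' k) (s := t)
    have h2 := hw.sum_inner_products_le (w' k) (s := t)
    rw [hv'.1, one_pow] at h1
    rw [hw'.1, one_pow] at h2
    simp only [norm_inner_symm (v' k)]
    rw [← Finset.sum_div, Finset.sum_add_distrib]
    linarith
  · exact fun i => hsq (by rw [NNReal.abs_eq]; exact hf1 _)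
  · exact fun k => hsq (by rw [NNReal.abs_eq]; exact hf1 _)
  · exact fun i k => hsq (hfL _ _)
  · refine fun i k => hsq ((abs_add_le _ _).trans ?_)
    rw [abs_of_nonneg (by positivity : (0 : ℝ) ≤ (a i : ℝ) + b k), mul_add]
    exact add_le_add (hf1 _) (hf1 _)

theorem IsSVD.summable_sq {A : HS 𝕜 H₁ H₂} {a : ℕ → ℝ≥0} {v : ℕ → H₁} {w : ℕ → H₂}
    (h : IsSVD A a v w) : Summable fun j => (a j : ℝ) ^ 2 := by
  have h1 := (orthonormal_dyad h.right_orthonormal h.left_orthonormal).inner_products_summable A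
  have h2 : (fun j : {j // a j ≠ 0} => (a j : ℝ) ^ 2) =
      fun j : {j // a j ≠ 0} => ‖⟪(dyad (w j) (v j) : HS 𝕜 H₁ H₂), A⟫_𝕜‖ ^ 2 := by
    funext j
    rw [inner_dyad, h.op_apply j.2, inner_smul_right, inner_self_eq_norm_sq_to_K,
      h.left_orthonormal.1 j]
    simp
  rw [← h2] at h1
  exact (summable_subtype_iff_indicator (s := {j | a j ≠ 0})
    (f := fun j => (a j : ℝ) ^ 2)).1 h1 |>.congr fun j => by
      by_cases hj : a j = 0 <;> simp [Set.indicator, hj]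

/-- A diagonal series `∑ cⱼ wⱼ ⊗ vⱼ` with square summable coefficients converges in `S₂` if the
vectors with `cⱼ ≠ 0` are orthonormal. -/
theorem summable_smul_dyad {a : ℕ → ℝ≥0} {v : ℕ → H₁} {w : ℕ → H₂}
    (hv : Orthonormal 𝕜 fun j : {j // a j ≠ 0} => v j)
    (hw : Orthonormal 𝕜 fun j : {j // a j ≠ 0} => w j) {c : ℕ → 𝕜} (hc0 : ∀ j, a j = 0 → c j = 0)
    (hc : Summable fun j => ‖c j‖ ^ 2) :
    Summable fun j => c j • (dyad (w j) (v j) : HS 𝕜 H₁ H₂) := by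
  refine summable_of_pairwise_orthogonal (𝕜 := 𝕜) (fun i j hij => ?_) (hc.congr fun j => ?_)
  · by_cases hi : a i = 0
    · simp [hc0 i hi]
    by_cases hj : a j = 0
    · simp [hc0 j hj]
    have := (orthonormal_dyad hv hw).2 (i := ⟨i, hi⟩) (j := ⟨j, hj⟩)
      fun h => hij (congrArg Subtype.val h)
    simp only [inner_smul_left, inner_smul_right, this, mul_zero]
  · by_cases hj : a j = 0
    · simp [hc0 j hj]
    have := (orthonormal_dyad hv hw).1 ⟨j, hj⟩
    rw [norm_smul, this, mul_one]

theorem IsSVD.hasSum_hs {A : HS 𝕜 H₁ H₂} {a : ℕ → ℝ≥0} {v : ℕ → H₁} {w : ℕ → H₂}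
    (h : IsSVD A a v w) :
    HasSum (fun j => ((a j : ℝ) : 𝕜) • (dyad (w j) (v j) : HS 𝕜 H₁ H₂)) A := by
  obtain ⟨B, hB⟩ := summable_smul_dyad h.right_orthonormal h.left_orthonormal
    (c := fun j => ((a j : ℝ) : 𝕜)) (fun j hj => by simp [hj]) (by simpa using h.summable_sq)
  have h1 : B = A := HS.op_injective ((hB.mapL (HS.opL 𝕜 H₁ H₂)).unique (by
    simpa only [map_smul, HS.opL_apply] using h.hasSum))
  rwa [h1] at hB

theorem IsSVD.summable_calc {A : HS 𝕜 H₁ H₂} {a : ℕ → ℝ≥0} {v : ℕ → H₁} {w : ℕ → H₂}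
    (h : IsSVD A a v w) (hf : LipschitzWith L f) (hf0 : f 0 = 0) :
    Summable fun j => ((f (a j) : ℝ) : 𝕜) • (dyad (w j) (v j) : HS 𝕜 H₁ H₂) := by
  refine summable_smul_dyad h.right_orthonormal h.left_orthonormal
    (fun j hj => by simp [hj, hf0]) ?_
  refine (h.summable_sq.mul_left ((L : ℝ) ^ 2)).of_nonneg_of_le (fun _ => by positivity)
    fun j => ?_
  rw [RCLike.norm_ofReal, ← mul_pow]
  exact pow_le_pow_left₀ (abs_nonneg _) (abs_le_of_lipschitzWith hf hf0 _) 2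

/-- The Lipschitz estimate for the functional calculus along two arbitrary singular value
decompositions. For `A = B` it shows that the value does not depend on the decomposition. -/
theorem IsSVD.norm_sub_le {A B X Y : HS 𝕜 H₁ H₂} {a b : ℕ → ℝ≥0} {v v' : ℕ → H₁} {w w' : ℕ → H₂}
    (hA : IsSVD A a v w) (hB : IsSVD B b v' w') (hf : LipschitzWith L f) (hf0 : f 0 = 0)
    (hX : HasSum (fun j => ((f (a j) : ℝ) : 𝕜) • (dyad (w j) (v j) : HS 𝕜 H₁ H₂)) X)
    (hY : HasSum (fun j => ((f (b j) : ℝ) : 𝕜) • (dyad (w' j) (v' j) : HS 𝕜 H₁ H₂)) Y) :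
    ‖X - Y‖ ≤ L * ‖A - B‖ := by
  have hsub : ∀ {a : ℕ → ℝ≥0} {v : ℕ → H₁} {w : ℕ → H₂} {g : ℝ≥0 → ℝ} {Z : HS 𝕜 H₁ H₂},
      g 0 = 0 → HasSum (fun j => ((g (a j) : ℝ) : 𝕜) • (dyad (w j) (v j) : HS 𝕜 H₁ H₂)) Z →
      HasSum (fun j : {j // a j ≠ 0} => ((g (a j) : ℝ) : 𝕜) • (dyad (w j) (v j) : HS 𝕜 H₁ H₂)) Z :=
    fun {a v w g Z} hg hZ => (hasSum_subtype_iff_of_support_subset (s := {j | a j ≠ 0})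
      fun j hj h0 => hj (by simp [h0, hg])).2 hZ
  have hA' := hsub (g := fun x => (x : ℝ)) rfl hA.hasSum_hs
  have hB' := hsub (g := fun x => (x : ℝ)) rfl hB.hasSum_hs
  have hX' := hsub hf0 hX
  have hY' := hsub hf0 hY
  have lim : ∀ {P Q : HS 𝕜 H₁ H₂} {ι κ : Type} {p : ι → HS 𝕜 H₁ H₂} {q : κ → HS 𝕜 H₁ H₂},
      HasSum p P → HasSum q Q → Filter.Tendsto
        (fun s : Finset ι × Finset κ => ‖∑ i ∈ s.1, p i - ∑ k ∈ s.2, q k‖)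
        (Filter.atTop ×ˢ Filter.atTop) (nhds ‖P - Q‖) := fun hP hQ =>
    ((Filter.Tendsto.comp hP Filter.tendsto_fst).sub
      (Filter.Tendsto.comp hQ Filter.tendsto_snd)).norm
  exact le_of_tendsto_of_tendsto' (lim hX' hY') ((lim hA' hB').const_mul (L : ℝ)) fun s =>
    norm_sub_le_of_lipschitz_svd hf hf0 hA.right_orthonormal hA.left_orthonormal
      hB.right_orthonormal hB.left_orthonormal (fun j => a j) (fun j => b j) s.1 s.2

theorem exists_isSVD_hasSum_svCalc (hf : LipschitzWith L f) (hf0 : f 0 = 0) (A : HS 𝕜 H₁ H₂) :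
    ∃ a v w, IsSVD A a v w ∧
      HasSum (fun j => ((f (a j) : ℝ) : 𝕜) • (dyad (w j) (v j) : HS 𝕜 H₁ H₂)) (svCalc f A) := by
  have h : ∃ d : (ℕ → ℝ≥0) × (ℕ → H₁) × (ℕ → H₂), IsSVD A d.1 d.2.1 d.2.2 := by
    obtain ⟨a, v, w, h⟩ := exists_isSVD A
    exact ⟨(a, v, w), h⟩
  refine ⟨_, _, _, h.choose_spec, ?_⟩
  rw [svCalc, dif_pos h]
  exact (h.choose_spec.summable_calc hf hf0).hasSum

theorem IsSVD.hasSum_svCalc {A : HS 𝕜 H₁ H₂} {a : ℕ → ℝ≥0} {v : ℕ → H₁} {w : ℕ → H₂}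
    (h : IsSVD A a v w) (hf : LipschitzWith L f) (hf0 : f 0 = 0) :
    HasSum (fun j => ((f (a j) : ℝ) : 𝕜) • (dyad (w j) (v j) : HS 𝕜 H₁ H₂)) (svCalc f A) := by
  obtain ⟨b, v', w', hb, hsum⟩ := exists_isSVD_hasSum_svCalc hf hf0 A
  obtain ⟨Y, hY⟩ := h.summable_calc hf hf0
  have h1 := h.norm_sub_le hb hf hf0 hY hsum
  rw [sub_self, norm_zero, mul_zero] at h1
  rwa [← sub_eq_zero.1 (norm_le_zero_iff.1 h1)]

theorem lipschitzWith_svCalc (hf : LipschitzWith L f) (hf0 : f 0 = 0) :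
    LipschitzWith L (svCalc f : HS 𝕜 H₁ H₂ → HS 𝕜 H₁ H₂) := by
  refine LipschitzWith.of_dist_le_mul fun A B => ?_
  obtain ⟨a, v, w, hA, hsA⟩ := exists_isSVD_hasSum_svCalc hf hf0 A
  obtain ⟨b, v', w', hB, hsB⟩ := exists_isSVD_hasSum_svCalc hf hf0 B
  rw [dist_eq_norm, dist_eq_norm]
  exact hA.norm_sub_le hB hf hf0 hsA hsB

end Calculus

/-! ### Diagonal operators -/

section Sigma

theorem real_sign_mul_abs (x : ℝ) : x.sign * |x| = x := by
  rcases lt_trichotomy x 0 with h | rfl | h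
  · rw [Real.sign_of_neg h, abs_of_neg h]; ring
  · simp
  · rw [Real.sign_of_pos h, abs_of_pos h, one_mul]

theorem summable_sq_mul_rpow {ω : ℕ → ℝ} (hω : ∀ j, 0 < ω j) {s : ℝ}
    (hsum : Summable fun j => ω j ^ (2 * s)) (r : ℝ) : Summable fun j => (r * ω j ^ s) ^ 2 := by
  refine (hsum.mul_left (r ^ 2)).congr fun j => ?_
  rw [mul_pow, ← Real.rpow_mul_natCast (hω j).le, Nat.cast_ofNat, mul_comm s]

variable {𝕜 : Type*} [RCLike 𝕜]
variable {H₁ : Type*} [NormedAddCommGroup H₁] [InnerProductSpace 𝕜 H₁] [CompleteSpace H₁]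
variable {H₂ : Type*} [NormedAddCommGroup H₂] [InnerProductSpace 𝕜 H₂]
variable {ω : ℕ → ℝ} {r s : ℝ} {v : ℕ → H₁} {w : ℕ → H₂}

theorem orthonormal_sign_smul (hw : Orthonormal 𝕜 w) {a : ℕ → ℝ≥0} {x : ℕ → ℝ}
    (hx : ∀ j, a j ≠ 0 → x j ≠ 0) :
    Orthonormal 𝕜 fun j : {j // a j ≠ 0} => (((x j).sign : ℝ) : 𝕜) • w j := by
  refine ⟨fun j => ?_, fun i j hij => ?_⟩
  · rw [norm_smul, hw.1, mul_one, RCLike.norm_ofReal]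
    rcases Real.sign_apply_eq_of_ne_zero _ (hx j j.2) with h | h <;> simp [h]
  · have := hw.2 fun h => hij (Subtype.ext h)
    simp only [inner_smul_left, inner_smul_right, this, mul_zero]

variable [CompleteSpace H₂]

theorem hasSum_hsSigma (hω : ∀ j, 0 < ω j) (hsum : Summable fun j => ω j ^ (2 * s))
    (hv : Orthonormal 𝕜 v) (hw : Orthonormal 𝕜 w) (u : ℕ → Icc (-1 : ℝ) 1) :
    HasSum (fun j => ((r * ω j ^ s * (u j : ℝ) : ℝ) : 𝕜) • (dyad (w j) (v j) : HS 𝕜 H₁ H₂))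
      (hsSigma ω r s v w u) := by
  refine Summable.hasSum ?_
  refine summable_smul_dyad (a := fun _ => 1) (hv.comp _ Subtype.val_injective)
    (hw.comp _ Subtype.val_injective) (fun j hj => absurd hj one_ne_zero) ?_
  refine (summable_sq_mul_rpow hω hsum r).of_nonneg_of_le (fun _ => by positivity) fun j => ?_
  rw [RCLike.norm_ofReal, sq_abs, mul_pow]
  refine mul_le_of_le_one_right (sq_nonneg _) ?_
  rw [sq_le_one_iff_abs_le_one]
  exact abs_le.2 (u j).2

theorem isSVD_hsSigma (hω : ∀ j, 0 < ω j) (hsum : Summable fun j => ω j ^ (2 * s)) (hr : 0 < r)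
    (hv : Orthonormal 𝕜 v) (hw : Orthonormal 𝕜 w) (u : ℕ → Icc (-1 : ℝ) 1) :
    IsSVD (hsSigma ω r s v w u : HS 𝕜 H₁ H₂)
      (fun j => Real.toNNReal (r * ω j ^ s * |(u j : ℝ)|))
      v (fun j => ((Real.sign (u j) : ℝ) : 𝕜) • w j) := by
  have hpos : ∀ j, 0 < r * ω j ^ s := fun j => mul_pos hr (Real.rpow_pos_of_pos (hω j) s)
  refine ⟨hv.comp _ Subtype.val_injective, orthonormal_sign_smul hw (x := fun j => u j)
    fun j hj h0 => hj (by simp [h0]), ?_⟩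
  have h1 := (hasSum_hsSigma (r := r) hω hsum hv hw u).mapL (HS.opL 𝕜 H₁ H₂)
  convert h1 using 1
  · funext j
    rw [dyad_smul_left, map_smul, ← HS.opL_apply, map_smul, smul_smul, ← RCLike.ofReal_mul,
      Real.coe_toNNReal _ (mul_nonneg (hpos j).le (abs_nonneg _)), mul_assoc, mul_comm |_|,
      real_sign_mul_abs]
  · rfl

theorem hsSigma_mem_hsCube (hω : ∀ j, 0 < ω j) (hsum : Summable fun j => ω j ^ (2 * s))
    (hr : 0 < r) (hv : Orthonormal 𝕜 v) (hw : Orthonormal 𝕜 w) (u : ℕ → Icc (-1 : ℝ) 1) :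
    (hsSigma ω r s v w u : HS 𝕜 H₁ H₂) ∈ hsCube 𝕜 H₁ H₂ ω r s := by
  refine ⟨_, _, _, isSVD_hsSigma hω hsum hr hv hw u, fun j => ?_⟩
  have hpos : 0 < r * ω j ^ s := mul_pos hr (Real.rpow_pos_of_pos (hω j) s)
  rw [Real.coe_toNNReal _ (mul_nonneg hpos.le (abs_nonneg _))]
  exact mul_le_of_le_one_right hpos.le (abs_le.2 (u j).2)

theorem hsDiag_hsSigma (hω : ∀ j, 0 < ω j) (hsum : Summable fun j => ω j ^ (2 * s))
    (hv : Orthonormal 𝕜 v) (hw : Orthonormal 𝕜 w) (u : ℕ → Icc (-1 : ℝ) 1) (j : ℕ) :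
    hsDiag v w (hsSigma ω r s v w u : HS 𝕜 H₁ H₂) j = ((r * ω j ^ s * (u j : ℝ) : ℝ) : 𝕜) := by
  have hD : Orthonormal 𝕜 fun j => (dyad (w j) (v j) : HS 𝕜 H₁ H₂) := orthonormal_dyad hv hw
  have h1 := (hasSum_hsSigma (r := r) hω hsum hv hw u).mapL
    (innerSL 𝕜 (dyad (w j) (v j) : HS 𝕜 H₁ H₂))
  rw [hsDiag, ← inner_dyad]
  refine h1.unique ?_
  have h2 := hasSum_single (f := fun k => ⟪(dyad (w j) (v j) : HS 𝕜 H₁ H₂),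
    ((r * ω k ^ s * (u k : ℝ) : ℝ) : 𝕜) • dyad (w k) (v k)⟫_𝕜) j fun k hkj => by
      rw [inner_smul_right, hD.2 hkj.symm, mul_zero]
  have h3 : ⟪(dyad (w j) (v j) : HS 𝕜 H₁ H₂),
      ((r * ω j ^ s * (u j : ℝ) : ℝ) : 𝕜) • dyad (w j) (v j)⟫_𝕜 =
        ((r * ω j ^ s * (u j : ℝ) : ℝ) : 𝕜) := by
    rw [inner_smul_right, inner_self_eq_norm_sq_to_K, hD.1]
    simp
  rw [h3] at h2
  exact h2

theorem svNetwork_hsSigma (hω : ∀ j, 0 < ω j) (hsum : Summable fun j => ω j ^ (2 * s))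
    (hr : 0 < r) (hv : Orthonormal 𝕜 v) (hw : Orthonormal 𝕜 w) (N : ℕ) (φ : ℕ → ℝ → ℝ)
    (u : ℕ → Icc (-1 : ℝ) 1) :
    svNetwork v w N φ (hsSigma ω r s v w u : HS 𝕜 H₁ H₂) =
      ∑ j ∈ Finset.range N,
        ((φ j (r * ω j ^ s * |(u j : ℝ)|) * (u j : ℝ).sign : ℝ) : 𝕜) • dyad (w j) (v j) := by
  refine Finset.sum_congr rfl fun j _ => ?_
  have hpos : 0 < r * ω j ^ s := mul_pos hr (Real.rpow_pos_of_pos (hω j) s)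
  rw [hsDiag_hsSigma hω hsum hv hw, RCLike.norm_ofReal, abs_mul, abs_of_pos hpos,
    ← RCLike.ofReal_div, ← RCLike.ofReal_mul]
  congr 3
  rcases eq_or_ne (u j : ℝ) 0 with h0 | h0
  · simp [h0]
  · rw [div_eq_iff (by positivity), mul_left_comm, real_sign_mul_abs]

/-- On the cube the error of an operator network splits into the errors of the scalar surrogates
at the retained singular values and the tail of the weights. -/
theorem norm_sq_svCalc_sub_svNetwork_le {f : ℝ≥0 → ℝ} {L : ℝ≥0} (hf : LipschitzWith L f)
    (hf0 : f 0 = 0) (hω : ∀ j, 0 < ω j) (hsum : Summable fun j => ω j ^ (2 * s))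
    (hr : 0 < r) (hv : Orthonormal 𝕜 v) (hw : Orthonormal 𝕜 w) (N : ℕ) (φ : ℕ → ℝ → ℝ)
    (u : ℕ → Icc (-1 : ℝ) 1) :
    ‖svCalc f (hsSigma ω r s v w u : HS 𝕜 H₁ H₂) - svNetwork v w N φ (hsSigma ω r s v w u)‖ ^ 2 ≤
      ∑ j ∈ Finset.range N, (f (Real.toNNReal (r * ω j ^ s * |(u j : ℝ)|)) -
          φ j (r * ω j ^ s * |(u j : ℝ)|)) ^ 2 +
        (L * r) ^ 2 * ∑' j, ω (j + N) ^ (2 * s) := by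
  set a : ℕ → ℝ≥0 := fun j => Real.toNNReal (r * ω j ^ s * |(u j : ℝ)|) with ha
  have hpos : ∀ j, 0 < r * ω j ^ s := fun j => mul_pos hr (Real.rpow_pos_of_pos (hω j) s)
  have hD : Orthonormal 𝕜 fun j => (dyad (w j) (v j) : HS 𝕜 H₁ H₂) := orthonormal_dyad hv hw
  have h1 := (isSVD_hsSigma hω hsum hr hv hw u).hasSum_svCalc hf hf0
  let d : ℕ → ℝ := fun j => if j < N then φ j (r * ω j ^ s * |(u j : ℝ)|) * (u j : ℝ).sign else 0
  have h2 : HasSum (fun j => (d j : 𝕜) • (dyad (w j) (v j) : HS 𝕜 H₁ H₂))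
      (svNetwork v w N φ (hsSigma ω r s v w u)) := by
    rw [svNetwork_hsSigma hω hsum hr hv hw]
    convert hasSum_sum_of_ne_finset_zero (f := fun j => (d j : 𝕜) •
      (dyad (w j) (v j) : HS 𝕜 H₁ H₂)) (s := Finset.range N) ?_ using 1
    · refine Finset.sum_congr rfl fun j hj => ?_
      simp only [d, if_pos (Finset.mem_range.1 hj)]
    · intro j hj
      have : ¬ j < N := fun h => hj (Finset.mem_range.2 h)
      simp [d, this]
    · infer_instance
  have h3 := h1.sub h2
  have h4 : (fun j => ((f (a j) : ℝ) : 𝕜) • (dyad (((u j : ℝ).sign : 𝕜) • w j) (v j) : HS 𝕜 H₁ H₂)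
      - (d j : 𝕜) • dyad (w j) (v j)) =
      fun j => ((f (a j) * (u j : ℝ).sign - d j : ℝ) : 𝕜) • dyad (w j) (v j) := by
    funext j
    rw [dyad_smul_left, smul_smul, RCLike.ofReal_sub, RCLike.ofReal_mul, sub_smul]
  rw [h4] at h3
  have h5 := hasSum_norm_sq_of_pairwise_orthogonal (𝕜 := 𝕜) (fun i j hij => by
    simp only [inner_smul_left, inner_smul_right, hD.2 hij, mul_zero]) h3
  have hsign : ∀ x : ℝ, x.sign ^ 2 ≤ 1 := fun x => by
    rcases Real.sign_apply_eq x with h | h | h <;> simp [h]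
  simp only [norm_smul, hD.1, mul_one, RCLike.norm_ofReal, sq_abs] at h5
  rw [← h5.tsum_eq, ← h5.summable.sum_add_tsum_nat_add N]
  have hshift : Summable fun j => ω (j + N) ^ (2 * s) :=
    (summable_nat_add_iff (f := fun j => ω j ^ (2 * s)) N).2 hsum
  refine add_le_add (Finset.sum_le_sum fun j hj => ?_) ?_
  · simp only [d, if_pos (Finset.mem_range.1 hj)]
    rw [← sub_mul, mul_pow]
    exact mul_le_of_le_one_right (sq_nonneg _) (hsign _)
  · rw [← tsum_mul_left]
    refine Summable.tsum_le_tsum (fun j => ?_)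
      ((summable_nat_add_iff (f := fun j => (f (a j) * (u j : ℝ).sign - d j) ^ 2) N).2 h5.summable)
      (hshift.mul_left _)
    have hn : ¬ j + N < N := by omega
    simp only [d, if_neg hn, sub_zero]
    have hle : |f (a (j + N))| ≤ L * (r * ω (j + N) ^ s) := by
      refine (abs_le_of_lipschitzWith hf hf0 _).trans (mul_le_mul_of_nonneg_left ?_ L.2)
      rw [ha, Real.coe_toNNReal _ (mul_nonneg (hpos _).le (abs_nonneg _))]
      exact mul_le_of_le_one_right (hpos _).le (abs_le.2 (u (j + N)).2)
    have hrw : ω (j + N) ^ (2 * s) = (ω (j + N) ^ s) ^ 2 := by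
      rw [← Real.rpow_mul_natCast (hω _).le, Nat.cast_ofNat, mul_comm s]
    rw [mul_pow, hrw, ← mul_pow (_ * r), mul_assoc (L : ℝ), ← sq_abs (f _)]
    exact (mul_le_of_le_one_right (sq_nonneg _) (hsign _)).trans
      (pow_le_pow_left₀ (abs_nonneg _) hle 2)

end Sigma

/-! ### Measurability and rescaling of scalar networks -/

section ScalarNetworks

variable {𝒜 : Set (ℝ → ℝ)}

theorem IsFeedforward.measurable (h𝒜 : ∀ a ∈ 𝒜, Measurable a) {m d n : ℕ}
    {F : (Fin d → ℝ) → (Fin m → ℝ)} (hF : IsFeedforward 𝒜 m d F n) : Measurable F := by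
  have haff : ∀ {k l : ℕ} (W : Matrix (Fin k) (Fin l) ℝ) (b : Fin k → ℝ),
      Measurable fun x => W.mulVec x + b := fun W b =>
    ((Continuous.matrix_mulVec continuous_const continuous_id).add continuous_const).measurable
  induction hF with
  | output W b => exact haff W b
  | hidden W b a F ha _ ih =>
    exact ih.comp (measurable_pi_lambda _ fun i =>
      (h𝒜 _ (ha i)).comp ((measurable_pi_apply i).comp (haff W b)))

theorem IsScalarNet.measurable (h𝒜 : ∀ a ∈ 𝒜, Measurable a) {h n : ℕ} {φ : ℝ → ℝ}
    (hφ : IsScalarNet 𝒜 h φ n) : Measurable φ := by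
  induction h generalizing φ n with
  | zero => exact h𝒜 φ hφ.1
  | succ h ih =>
    obtain ⟨q, ρ, p, F, k, hρ, hF, hφF, -⟩ := hφ
    have hFm : Measurable F := hF.measurable (by
      rintro _ ⟨i, rfl⟩
      rcases hρ i with hi | hi
      · exact h𝒜 _ hi.1
      · exact ih hi)
    rw [funext hφF]
    exact (measurable_pi_apply 0).comp (hFm.comp (measurable_pi_lambda _ fun _ => measurable_id))

theorem affineSize_smul {k m : ℕ} (W : Matrix (Fin m) (Fin k) ℝ) (b : Fin m → ℝ) {c : ℝ}
    (hc : c ≠ 0) : affineSize (c • W) b = affineSize W b := by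
  simp [affineSize, hc]

/-- Rescaling the input is absorbed into the weights of the first layer, without changing the
number of nonzero parameters. -/
theorem IsFeedforward.comp_smul {m d n : ℕ} {F : (Fin d → ℝ) → (Fin m → ℝ)}
    (hF : IsFeedforward 𝒜 m d F n) {c : ℝ} (hc : c ≠ 0) :
    IsFeedforward 𝒜 m d (fun x => F (c • x)) n := by
  cases hF with
  | output W b =>
    rw [← affineSize_smul W b hc]
    simp only [Matrix.mulVec_smul, ← Matrix.smul_mulVec]
    exact .output (c • W) b
  | hidden W b a F ha hF =>
    rw [← affineSize_smul W b hc]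
    simp only [Matrix.mulVec_smul, ← Matrix.smul_mulVec]
    exact .hidden (c • W) b a F ha hF

theorem IsScalarNet.comp_mul {h n : ℕ} {φ : ℝ → ℝ} (hh : 1 ≤ h) (hφ : IsScalarNet 𝒜 h φ n) {c : ℝ}
    (hc : c ≠ 0) : IsScalarNet 𝒜 h (fun x => φ (c * x)) n := by
  obtain ⟨h, rfl⟩ := Nat.exists_eq_succ_of_ne_zero (Nat.one_le_iff_ne_zero.1 hh)
  obtain ⟨q, ρ, p, F, k, hρ, hF, hφF, hn⟩ := hφ
  exact ⟨q, ρ, p, fun x => F (c • x), k, hρ, hF.comp_smul hc, fun x => hφF (c * x), hn⟩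

end ScalarNetworks

/-! ### Marginals of the uniform measure on the cube -/

section Cube

theorem setLIntegral_comp_mul_le {G : ℝ → ℝ≥0∞} (hG : Measurable G) {c : ℝ} (hc : c ≠ 0)
    {S T : Set ℝ} (hS : MeasurableSet S) (hT : MeasurableSet T) (hST : ∀ x ∈ S, c * x ∈ T) :
    ∫⁻ x in S, G (c * x) ≤ ENNReal.ofReal |c⁻¹| * ∫⁻ t in T, G t := by
  calc ∫⁻ x in S, G (c * x) = ∫⁻ x in S, T.indicator G (c * x) :=
        setLIntegral_congr_fun hS fun x hx => by rw [indicator_of_mem (hST x hx)]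
    _ ≤ ∫⁻ x, T.indicator G (c * x) := setLIntegral_le_lintegral _ _
    _ = ∫⁻ y, T.indicator G y ∂(Measure.map (c * ·) volume) :=
        (lintegral_map (hG.indicator hT) (measurable_const_mul c)).symm
    _ = ENNReal.ofReal |c⁻¹| * ∫⁻ t in T, G t := by
        rw [Real.map_volume_mul_left hc, lintegral_smul_measure, lintegral_indicator hT,
          smul_eq_mul]

/-- The variable `c |uⱼ|` is uniformly distributed on `[0, c]`, so that its density with respect to
Lebesgue measure is at most `c⁻¹` on `[0, 1]`. -/
theorem lintegral_cubeMeasure_le {G : ℝ → ℝ≥0∞} (hG : Measurable G) {c : ℝ} (hc : 0 < c)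
    (hc1 : c ≤ 1) (j : ℕ) :
    ∫⁻ u, G (c * |(u j : ℝ)|) ∂cubeMeasure ≤ ENNReal.ofReal c⁻¹ * ∫⁻ t in Icc (0 : ℝ) 1, G t := by
  have hm : Measurable fun x : ℝ => G (c * |x|) :=
    hG.comp (measurable_const.mul continuous_abs.measurable)
  have h1 : ∫⁻ u, G (c * |(u j : ℝ)|) ∂cubeMeasure =
      2⁻¹ * ∫⁻ x in Icc (-1 : ℝ) 1, G (c * |x|) := by
    rw [cubeMeasure, (measurePreserving_eval_infinitePi (fun _ : ℕ => uniformIcc) j).lintegral_comp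
      (f := fun x : Icc (-1 : ℝ) 1 => G (c * |(x : ℝ)|)) (hm.comp measurable_subtype_coe),
      uniformIcc, lintegral_smul_measure, smul_eq_mul,
      lintegral_subtype_comap measurableSet_Icc fun x : ℝ => G (c * |x|)]
  have habs : |c⁻¹| = c⁻¹ := abs_of_pos (inv_pos.2 hc)
  have hneg : ∫⁻ x in Icc (-1 : ℝ) 0, G (c * |x|) ≤
      ENNReal.ofReal c⁻¹ * ∫⁻ t in Icc (0 : ℝ) 1, G t := by
    rw [setLIntegral_congr_fun measurableSet_Icc (g := fun x => G (-c * x)) fun x hx => by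
      simp only [abs_of_nonpos hx.2, neg_mul, mul_neg]]
    have := setLIntegral_comp_mul_le hG (neg_ne_zero.2 hc.ne') (S := Icc (-1 : ℝ) 0)
      (T := Icc (0 : ℝ) 1) measurableSet_Icc measurableSet_Icc fun x hx =>
        ⟨by nlinarith [hx.1, hx.2], by nlinarith [hx.1, hx.2]⟩
    rwa [inv_neg, abs_neg, habs] at this
  have hpos : ∫⁻ x in Icc (0 : ℝ) 1, G (c * |x|) ≤
      ENNReal.ofReal c⁻¹ * ∫⁻ t in Icc (0 : ℝ) 1, G t := by
    rw [setLIntegral_congr_fun measurableSet_Icc (g := fun x => G (c * x)) fun x hx => by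
      simp only [abs_of_nonneg hx.1]]
    have := setLIntegral_comp_mul_le hG hc.ne' (S := Icc (0 : ℝ) 1)
      (T := Icc (0 : ℝ) 1) measurableSet_Icc measurableSet_Icc fun x hx =>
        ⟨by nlinarith [hx.1, hx.2], by nlinarith [hx.1, hx.2]⟩
    rwa [habs] at this
  have h2 : ∫⁻ x in Icc (-1 : ℝ) 1, G (c * |x|) ≤
      (∫⁻ x in Icc (-1 : ℝ) 0, G (c * |x|)) + ∫⁻ x in Icc (0 : ℝ) 1, G (c * |x|) := by
    rw [← Icc_union_Icc_eq_Icc (by norm_num : (-1 : ℝ) ≤ 0) zero_le_one]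
    exact lintegral_union_le _ _ _
  rw [h1]
  calc 2⁻¹ * ∫⁻ x in Icc (-1 : ℝ) 1, G (c * |x|)
      ≤ 2⁻¹ * (2 * (ENNReal.ofReal c⁻¹ * ∫⁻ t in Icc (0 : ℝ) 1, G t)) := by
        gcongr
        rw [two_mul]
        exact h2.trans (add_le_add hneg hpos)
    _ = ENNReal.ofReal c⁻¹ * ∫⁻ t in Icc (0 : ℝ) 1, G t := by
        rw [← mul_assoc, ENNReal.inv_mul_cancel two_ne_zero ENNReal.ofNat_ne_top, one_mul]

end Cube

/-! ### Truncation of the weights -/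

section Truncation

/-- The level `n` is the least one whose tail `∑_{j > n} ωⱼ^{2s}` is below `c ε²`; it is chosen
independently of the exponent `q`. By minimality
`c ε² < ∑_{j ≥ n} ωⱼ^{2s} ≤ ωₙ^{2/q} ∑ ω^{1+η}` with `1 + η = 2s - 2/q`, which bounds `ωₙ` from
below. -/
theorem exists_truncation {ω : ℕ → ℝ} (hω : ∀ j, 0 < ω j) (hωmono : Antitone ω)
    (hωsum : ∀ η : ℝ, 0 < η → Summable fun j => ω j ^ (1 + η)) {s : ℝ} (hs : 1 / 2 < s)
    {c : ℝ} (hc : 0 < c) :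
    ∃ n : ℝ → ℕ, (∀ ε ∈ Ioc (0 : ℝ) 1, ∑' j, ω (j + (n ε + 1)) ^ (2 * s) ≤ c * ε ^ 2) ∧
      ∀ q : ℝ, 1 / (s - 1 / 2) < q → ∃ C : ℝ, 0 < C ∧ ∀ ε ∈ Ioc (0 : ℝ) 1,
        (ω (n ε))⁻¹ ≤ C * ε ^ (-q) := by
  classical
  have hsum : Summable fun j => ω j ^ (2 * s) := by
    simpa using hωsum (2 * s - 1) (by linarith)
  have hex : ∀ ε : ℝ, 0 < ε → ∃ n, ∑' j, ω (j + (n + 1)) ^ (2 * s) ≤ c * ε ^ 2 := by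
    intro ε hε
    have h1 := (tendsto_sum_nat_add fun j => ω j ^ (2 * s)).comp (Filter.tendsto_add_atTop_nat 1)
    obtain ⟨n, hn⟩ := (h1.eventually (gt_mem_nhds (by positivity : 0 < c * ε ^ 2))).exists
    exact ⟨n, hn.le⟩
  let n : ℝ → ℕ := fun ε => if h : 0 < ε then Nat.find (hex ε h) else 0
  refine ⟨n, fun ε hε => ?_, fun q hq => ?_⟩
  · simp only [n, dif_pos hε.1]
    exact Nat.find_spec (hex ε hε.1)
  · have hs' : 0 < s - 1 / 2 := by linarith
    have hq0 : 0 < q := (by positivity : 0 < 1 / (s - 1 / 2)).trans hq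
    have hη : 0 < 2 * s - 2 / q - 1 := by
      rw [div_lt_iff₀ hs'] at hq
      have : 2 / q < 2 * s - 1 := by rw [div_lt_iff₀ hq0]; linarith
      linarith
    have hS : Summable fun j => ω j ^ (2 * s - 2 / q) := by
      simpa using hωsum _ hη
    set S : ℝ := ∑' j, ω j ^ (2 * s - 2 / q) with hSdef
    have hSpos : 0 < S := hS.tsum_pos (fun j => (Real.rpow_pos_of_pos (hω j) _).le) 0
      (Real.rpow_pos_of_pos (hω 0) _)
    refine ⟨max (ω 0)⁻¹ ((S / c) ^ (q / 2)), lt_max_of_lt_left (inv_pos.2 (hω 0)), fun ε hε => ?_⟩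
    have hε1 : 1 ≤ ε ^ (-q) := Real.one_le_rpow_of_pos_of_le_one_of_nonpos hε.1 hε.2 (by linarith)
    rcases Nat.eq_zero_or_pos (n ε) with h0 | h0
    · rw [h0]
      calc (ω 0)⁻¹ ≤ max (ω 0)⁻¹ ((S / c) ^ (q / 2)) * 1 := by rw [mul_one]; exact le_max_left _ _
        _ ≤ _ := by gcongr
    · have hlt : c * ε ^ 2 < ∑' j, ω (j + n ε) ^ (2 * s) := by
        have := Nat.find_min (hex ε hε.1) (m := n ε - 1) (by
          simp only [n, dif_pos hε.1] at h0 ⊢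
          omega)
        rwa [Nat.sub_add_cancel h0, not_le] at this
      have hle : ∑' j, ω (j + n ε) ^ (2 * s) ≤ ω (n ε) ^ (2 / q) * S := by
        have hS' := (summable_nat_add_iff (f := fun j => ω j ^ (2 * s - 2 / q)) (n ε)).2 hS
        calc ∑' j, ω (j + n ε) ^ (2 * s)
            ≤ ∑' j, ω (n ε) ^ (2 / q) * ω (j + n ε) ^ (2 * s - 2 / q) := by
              refine Summable.tsum_le_tsum (fun j => ?_)
                ((summable_nat_add_iff (f := fun j => ω j ^ (2 * s)) (n ε)).2 hsum)
                (hS'.mul_left _)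
              have : 2 * s = 2 / q + (2 * s - 2 / q) := by ring
              nth_rewrite 1 [this]
              rw [Real.rpow_add (hω _)]
              refine mul_le_mul_of_nonneg_right ?_ (Real.rpow_nonneg (hω _).le _)
              exact Real.rpow_le_rpow (hω _).le (hωmono (by omega)) (by positivity)
          _ = ω (n ε) ^ (2 / q) * ∑' j, ω (j + n ε) ^ (2 * s - 2 / q) := tsum_mul_left
          _ ≤ ω (n ε) ^ (2 / q) * S := by
              refine mul_le_mul_of_nonneg_left ?_ (Real.rpow_nonneg (hω _).le _)
              rw [hSdef, ← hS.sum_add_tsum_nat_add (n ε)]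
              exact le_add_of_nonneg_left
                (Finset.sum_nonneg fun j _ => Real.rpow_nonneg (hω j).le _)
      have hX : (ω (n ε))⁻¹ ^ (2 / q) ≤ S / c * ε ^ (-2 : ℝ) := by
        have hωq : 0 < ω (n ε) ^ (2 / q) := Real.rpow_pos_of_pos (hω _) _
        rw [Real.inv_rpow (hω _).le, Real.rpow_neg hε.1.le, Real.rpow_two, ← div_eq_mul_inv,
          div_div, inv_le_comm₀ hωq (by have := hε.1; positivity), inv_div,
          div_le_iff₀ hSpos]
        exact (hlt.trans_le hle).le
      have hpow := Real.rpow_le_rpow (Real.rpow_nonneg (inv_nonneg.2 (hω _).le) _) hX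
        (by positivity : 0 ≤ q / 2)
      rw [← Real.rpow_mul (inv_nonneg.2 (hω _).le), Real.mul_rpow (by positivity)
        (Real.rpow_nonneg hε.1.le _), ← Real.rpow_mul hε.1.le] at hpow
      have e1 : 2 / q * (q / 2) = 1 := by field_simp
      have e2 : -2 * (q / 2) = -q := by ring
      rw [e1, e2, Real.rpow_one] at hpow
      refine hpow.trans (mul_le_mul_of_nonneg_right (le_max_right _ _) (by linarith))

theorem truncation_level_le {ω : ℕ → ℝ} (hω : ∀ j, 0 < ω j) (hωmono : Antitone ω)
    (hωsum : ∀ η : ℝ, 0 < η → Summable fun j => ω j ^ (1 + η)) {q₀ : ℝ} (hq₀ : 0 < q₀)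
    {n : ℝ → ℕ} (hn : ∀ q : ℝ, q₀ < q → ∃ C : ℝ, 0 < C ∧ ∀ ε ∈ Ioc (0 : ℝ) 1,
      (ω (n ε))⁻¹ ≤ C * ε ^ (-q)) (q : ℝ) (hq : q₀ < q) :
    ∃ C : ℝ, 0 < C ∧ ∀ ε ∈ Ioc (0 : ℝ) 1, ((n ε + 1 : ℕ) : ℝ) ≤ C * ε ^ (-q) := by
  -- interpolate `q' < q` and use summability with the exponent `1 + η = q / q'`
  obtain ⟨q', hq₁, hq₂⟩ := exists_between hq
  have hq' : 0 < q' := hq₀.trans hq₁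
  obtain ⟨C, hC, hCε⟩ := hn q' hq₁
  have hpos : 0 < q / q' := div_pos (hq'.trans hq₂) hq'
  have hS : Summable fun j => ω j ^ (q / q') := by
    simpa using hωsum (q / q' - 1) (by rw [sub_pos, one_lt_div hq']; exact hq₂)
  set S : ℝ := ∑' j, ω j ^ (q / q') with hSdef
  have hSpos : 0 < S := hS.tsum_pos (fun j => (Real.rpow_pos_of_pos (hω j) _).le) 0
    (Real.rpow_pos_of_pos (hω 0) _)
  refine ⟨S * C ^ (q / q'), mul_pos hSpos (Real.rpow_pos_of_pos hC _), fun ε hε => ?_⟩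
  have h1 : ((n ε + 1 : ℕ) : ℝ) * ω (n ε) ^ (q / q') ≤ S := by
    refine le_trans ?_ (hS.sum_le_tsum (Finset.range (n ε + 1))
      fun j _ => Real.rpow_nonneg (hω j).le _)
    rw [← nsmul_eq_mul, ← Finset.card_range (n ε + 1), ← Finset.sum_const, Finset.card_range]
    exact Finset.sum_le_sum fun j hj => Real.rpow_le_rpow (hω _).le
      (hωmono (Nat.lt_succ_iff.1 (Finset.mem_range.1 hj))) hpos.le
  have h2 : ((n ε + 1 : ℕ) : ℝ) ≤ S * (ω (n ε))⁻¹ ^ (q / q') := by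
    rw [Real.inv_rpow (hω _).le, ← div_eq_mul_inv, le_div_iff₀ (Real.rpow_pos_of_pos (hω _) _)]
    exact h1
  have h3 := Real.rpow_le_rpow (inv_nonneg.2 (hω (n ε)).le) (hCε ε hε) hpos.le
  rw [Real.mul_rpow hC.le (Real.rpow_nonneg hε.1.le _), ← Real.rpow_mul hε.1.le] at h3
  have e : -q' * (q / q') = -q := by field_simp
  rw [e] at h3
  calc _ ≤ S * (ω (n ε))⁻¹ ^ (q / q') := h2
    _ ≤ S * (C ^ (q / q') * ε ^ (-q)) := mul_le_mul_of_nonneg_left h3 hSpos.le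
    _ = _ := by ring

/-- The cost of a scalar surrogate of accuracy `ε'` in terms of a coarser scale `ε`. -/
theorem surrogate_cost_le {K β κ C τ ε ε' : ℝ} (hK : 0 ≤ K) (hβ : 0 ≤ β) (hκ : 0 ≤ κ) (hC : 0 < C)
    (hτ : 0 ≤ τ) (hε : ε ∈ Ioc (0 : ℝ) 1) (hε' : ε' ∈ Ioc (0 : ℝ) 1)
    (h : ε'⁻¹ ≤ C * ε ^ (-τ)) :
    K * ε' ^ (-β) * (1 + |Real.log ε'|) ^ κ ≤
      K * C ^ β * (1 + |Real.log C| + τ) ^ κ * ε ^ (-(τ * β)) * (1 + |Real.log ε|) ^ κ := by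
  have hετ : 0 < ε ^ (-τ) := Real.rpow_pos_of_pos hε.1 _
  have h1 : ε' ^ (-β) ≤ C ^ β * ε ^ (-(τ * β)) := by
    rw [Real.rpow_neg hε'.1.le, ← Real.inv_rpow hε'.1.le]
    refine (Real.rpow_le_rpow (inv_nonneg.2 hε'.1.le) h hβ).trans_eq ?_
    rw [Real.mul_rpow hC.le hετ.le, ← Real.rpow_mul hε.1.le, neg_mul]
  have h2 : 1 + |Real.log ε'| ≤ (1 + |Real.log C| + τ) * (1 + |Real.log ε|) := by
    have hl := Real.log_le_log (inv_pos.2 hε'.1) h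
    rw [Real.log_inv, Real.log_mul hC.ne' hετ.ne', Real.log_rpow hε.1] at hl
    rw [abs_of_nonpos (Real.log_nonpos hε'.1.le hε'.2)]
    have hC' := le_abs_self (Real.log C)
    have hC0 := abs_nonneg (Real.log C)
    have hε0 := abs_of_nonpos (Real.log_nonpos hε.1.le hε.2)
    have hε1 := abs_nonneg (Real.log ε)
    nlinarith [mul_nonneg hC0 hε1]
  have h3 := Real.rpow_le_rpow (by positivity) h2 hκ
  rw [Real.mul_rpow (by positivity) (by positivity)] at h3
  calc K * ε' ^ (-β) * (1 + |Real.log ε'|) ^ κ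
      ≤ K * (C ^ β * ε ^ (-(τ * β))) *
        ((1 + |Real.log C| + τ) ^ κ * (1 + |Real.log ε|) ^ κ) := by
        gcongr
        exact mul_nonneg hK (mul_nonneg (Real.rpow_nonneg hC.le _) (Real.rpow_nonneg hε.1.le _))
    _ = _ := by ring

theorem exists_pos_le_one_sq_mul_le_half {B : ℝ} (hB : 0 ≤ B) :
    ∃ c : ℝ, 0 < c ∧ c ≤ 1 ∧ c ^ 2 * B ≤ 1 / 2 := by
  refine ⟨1 / (2 * (1 + B)), by positivity, ?_, ?_⟩
  · rw [div_le_one (by positivity)]; linarith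
  · rw [div_pow, one_pow, div_mul_eq_mul_div, div_le_div_iff₀ (by positivity) (by norm_num)]
    nlinarith [sq_nonneg B]

end Truncation

/-! ### Error bounds for operator networks -/

section ErrorBounds

theorem eLpNorm_two_le_ofReal_iff {α E : Type*} [MeasurableSpace α] [NormedAddCommGroup E]
    {μ : Measure α} {g : α → E} {b : ℝ} (hb : 0 ≤ b) :
    eLpNorm g 2 μ ≤ ENNReal.ofReal b ↔ ∫⁻ x, ‖g x‖ₑ ^ 2 ∂μ ≤ ENNReal.ofReal (b ^ 2) := by
  have h := eLpNorm_nnreal_pow_eq_lintegral (f := g) (μ := μ) (p := 2) two_ne_zero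
  simp only [NNReal.coe_ofNat, ENNReal.coe_ofNat, ENNReal.rpow_ofNat] at h
  rw [← h, ENNReal.ofReal_pow hb]
  exact (ENNReal.pow_le_pow_left_iff two_ne_zero).symm

theorem enorm_sq_eq_ofReal {E : Type*} [NormedAddCommGroup E] (x : E) :
    ‖x‖ₑ ^ 2 = ENNReal.ofReal (‖x‖ ^ 2) := by
  rw [← ofReal_norm, ENNReal.ofReal_pow (norm_nonneg _)]

variable {f : ℝ≥0 → ℝ} {L : ℝ≥0} {𝒜 : Set (ℝ → ℝ)} {h : ℕ} {β κ : ℝ}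

/-- A surrogate of `f` on `[0, M]`, obtained by rescaling one on `[0, 1]`. At a singular value that
is uniformly distributed on `[0, a]` with `a ≤ M` its mean square error grows by the factor
`M / a`. -/
theorem SurrogateProperty.exists_net (hsurr : SurrogateProperty 𝒜 h β κ)
    (h𝒜 : ∀ a ∈ 𝒜, Measurable a) (hh : 1 ≤ h) (hf : LipschitzWith L f) (hL : 0 < L) :
    ∃ K : ℝ, 0 < K ∧ ∀ M : ℝ, 0 < M → ∀ ε ∈ Ioc (0 : ℝ) 1, ∃ (φ : ℝ → ℝ) (n : ℕ),
      IsScalarNet 𝒜 h φ n ∧ (n : ℝ) ≤ K * ε ^ (-β) * (1 + |Real.log ε|) ^ κ ∧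
      ∀ a, 0 < a → a ≤ M → ∀ j,
        ∫⁻ u, ENNReal.ofReal ((f (Real.toNNReal (a * |(u j : ℝ)|)) - φ (a * |(u j : ℝ)|)) ^ 2)
          ∂cubeMeasure ≤ ENNReal.ofReal (M / a * (L * M * ε) ^ 2) := by
  obtain ⟨K, hK, hnet⟩ := hsurr
  refine ⟨K, hK, fun M hM ε hε => ?_⟩
  have hg : LipschitzWith (L * M.toNNReal) fun x : ℝ => f (Real.toNNReal (M * x)) := by
    refine hf.comp (LipschitzWith.of_dist_le_mul fun x y => ?_)
    rw [Real.coe_toNNReal M hM.le]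
    have h1 := Real.lipschitzWith_toNNReal.dist_le_mul (M * x) (M * y)
    rw [NNReal.coe_one, one_mul, Real.dist_eq, ← mul_sub, abs_mul, abs_of_pos hM] at h1
    exact h1
  obtain ⟨φ, n, hφ, hn, herr⟩ := hnet (L * M.toNNReal) (fun x => f (Real.toNNReal (M * x)))
    (mul_pos hL (Real.toNNReal_pos.2 hM)) hg.lipschitzOnWith ε hε
  have hφm := hφ.measurable h𝒜
  refine ⟨fun x => φ (M⁻¹ * x), n, hφ.comp_mul hh (inv_ne_zero hM.ne'), hn, fun a ha haM j => ?_⟩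
  rw [eLpNorm_two_le_ofReal_iff (by have := hε.1; positivity)] at herr
  rw [NNReal.coe_mul, Real.coe_toNNReal M hM.le] at herr
  have hG : Measurable fun t : ℝ => ‖f (Real.toNNReal (M * t)) - φ t‖ₑ ^ 2 :=
    ((hg.continuous.measurable.sub hφm).enorm).pow_const 2
  have h1 := lintegral_cubeMeasure_le hG (c := a / M) (by positivity)
    (by rwa [div_le_one hM]) j
  rw [inv_div] at h1
  calc _ = ∫⁻ u : ℕ → Icc (-1 : ℝ) 1, ‖f (Real.toNNReal (M * (a / M * |(u j : ℝ)|))) -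
        φ (a / M * |(u j : ℝ)|)‖ₑ ^ 2 ∂cubeMeasure := by
        refine lintegral_congr fun u => ?_
        have e1 : M * (a / M * |(u j : ℝ)|) = a * |(u j : ℝ)| := by field_simp
        have e2 : a / M * |(u j : ℝ)| = M⁻¹ * (a * |(u j : ℝ)|) := by ring
        rw [e1, e2, enorm_sq_eq_ofReal, Real.norm_eq_abs, sq_abs]
    _ ≤ _ := h1
    _ ≤ ENNReal.ofReal (M / a) * ENNReal.ofReal ((L * M * ε) ^ 2) := by gcongr
    _ = _ := (ENNReal.ofReal_mul (by positivity)).symm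

variable {𝕜 : Type*} [RCLike 𝕜]
variable {H₁ : Type*} [NormedAddCommGroup H₁] [InnerProductSpace 𝕜 H₁] [CompleteSpace H₁]
variable {H₂ : Type*} [NormedAddCommGroup H₂] [InnerProductSpace 𝕜 H₂] [CompleteSpace H₂]
variable {ω : ℕ → ℝ} {r s : ℝ} {v : ℕ → H₁} {w : ℕ → H₂}

theorem eLpNorm_svCalc_sub_svNetwork_le (hf : LipschitzWith L f)
    (hf0 : f 0 = 0) (hω : ∀ j, 0 < ω j) (hsum : Summable fun j => ω j ^ (2 * s))
    (hr : 0 < r) (hv : Orthonormal 𝕜 v) (hw : Orthonormal 𝕜 w) {N : ℕ} {φ : ℕ → ℝ → ℝ}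
    (hφ : ∀ j, Measurable (φ j)) {ε : ℝ} (hε : 0 ≤ ε) {e : ℕ → ℝ} (he : ∀ j, 0 ≤ e j)
    (hφe : ∀ j < N, ∫⁻ u, ENNReal.ofReal ((f (Real.toNNReal (r * ω j ^ s * |(u j : ℝ)|)) -
      φ j (r * ω j ^ s * |(u j : ℝ)|)) ^ 2) ∂cubeMeasure ≤ ENNReal.ofReal (e j))
    (hesum : ∑ j ∈ Finset.range N, e j ≤ ε ^ 2 / 2)
    (htail : (L * r) ^ 2 * ∑' j, ω (j + N) ^ (2 * s) ≤ ε ^ 2 / 2) :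
    eLpNorm (fun A : HS 𝕜 H₁ H₂ => svCalc f A - svNetwork v w N φ A) 2
      (cubeMeasure.map (hsSigma ω r s v w)) ≤ ENNReal.ofReal ε := by
  rw [eLpNorm_two_le_ofReal_iff hε]
  refine (lintegral_map_le _ _).trans ?_
  let g : ℕ → (ℕ → Icc (-1 : ℝ) 1) → ℝ := fun j u =>
    (f (Real.toNNReal (r * ω j ^ s * |(u j : ℝ)|)) - φ j (r * ω j ^ s * |(u j : ℝ)|)) ^ 2
  have hg : ∀ j, Measurable (g j) := by
    intro j
    have hm : Measurable fun u : ℕ → Icc (-1 : ℝ) 1 => r * ω j ^ s * |(u j : ℝ)| :=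
      measurable_const.mul (continuous_abs.measurable.comp
        (measurable_subtype_coe.comp (measurable_pi_apply j)))
    exact ((hf.continuous.measurable.comp hm.real_toNNReal).sub ((hφ j).comp hm)).pow_const 2
  calc ∫⁻ u, ‖svCalc f (hsSigma ω r s v w u : HS 𝕜 H₁ H₂) -
        svNetwork v w N φ (hsSigma ω r s v w u)‖ₑ ^ 2 ∂cubeMeasure
      ≤ ∫⁻ u, (∑ j ∈ Finset.range N, ENNReal.ofReal (g j u)) + ENNReal.ofReal (ε ^ 2 / 2)
          ∂cubeMeasure := by
        refine lintegral_mono fun u => ?_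
        rw [enorm_sq_eq_ofReal, ← ENNReal.ofReal_sum_of_nonneg fun j _ => sq_nonneg _,
          ← ENNReal.ofReal_add (Finset.sum_nonneg fun j _ => sq_nonneg _) (by positivity)]
        refine ENNReal.ofReal_le_ofReal
          ((norm_sq_svCalc_sub_svNetwork_le hf hf0 hω hsum hr hv hw N φ u).trans ?_)
        exact add_le_add le_rfl htail
    _ = (∑ j ∈ Finset.range N, ∫⁻ u, ENNReal.ofReal (g j u) ∂cubeMeasure) +
          ENNReal.ofReal (ε ^ 2 / 2) := by
        have : IsProbabilityMeasure cubeMeasure := by unfold cubeMeasure; infer_instance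
        rw [lintegral_add_right _ measurable_const,
          lintegral_finsetSum _ fun j _ => (hg j).ennreal_ofReal]
        simp
    _ ≤ (∑ j ∈ Finset.range N, ENNReal.ofReal (e j)) + ENNReal.ofReal (ε ^ 2 / 2) := by
        gcongr with j hj
        exact hφe j (Finset.mem_range.1 hj)
    _ ≤ ENNReal.ofReal (ε ^ 2 / 2) + ENNReal.ofReal (ε ^ 2 / 2) := by
        rw [← ENNReal.ofReal_sum_of_nonneg fun j _ => he j]
        gcongr
    _ = ENNReal.ofReal (ε ^ 2) := by
        rw [← ENNReal.ofReal_add (by positivity) (by positivity), add_halves]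

end ErrorBounds

/-! ### Approximation rates -/

section Rates

variable {f : ℝ≥0 → ℝ} {L : ℝ≥0} {𝒜 : Set (ℝ → ℝ)} {h : ℕ} {β κ : ℝ}
variable {ω : ℕ → ℝ} {r s : ℝ}

/-- One surrogate of accuracy proportional to `ε` for each retained singular value: the squared
errors carry the summable weights `ωⱼ^{2s}`. -/
theorem exists_individual_networks (𝕜 : Type*) [RCLike 𝕜]
    (H₁ : Type*) [NormedAddCommGroup H₁] [InnerProductSpace 𝕜 H₁] [CompleteSpace H₁]
    (H₂ : Type*) [NormedAddCommGroup H₂] [InnerProductSpace 𝕜 H₂] [CompleteSpace H₂]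
    (hf : LipschitzWith L f) (hf0 : f 0 = 0) (hL : 0 < L)
    (h𝒜 : ∀ a ∈ 𝒜, Measurable a) (hh : 1 ≤ h)
    (hβ : 0 ≤ β) (hκ : 0 ≤ κ) (hsurr : SurrogateProperty 𝒜 h β κ)
    (hω : ∀ j, 0 < ω j) (hωmono : Antitone ω)
    (hωsum : ∀ η : ℝ, 0 < η → Summable fun j => ω j ^ (1 + η)) (hr : 0 < r) (hs : 1 / 2 < s) :
    ∃ (N : ℝ → ℕ) (φ : ℝ → ℕ → ℝ → ℝ) (p : ℝ → ℕ → ℕ),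
      (∀ ε ∈ Ioc (0 : ℝ) 1, ∀ j < N ε, IsScalarNet 𝒜 h (φ ε j) (p ε j)) ∧
      (∀ (v : ℕ → H₁) (w : ℕ → H₂), Orthonormal 𝕜 v → Orthonormal 𝕜 w → ∀ ε ∈ Ioc (0 : ℝ) 1,
        eLpNorm (fun A : HS 𝕜 H₁ H₂ => svCalc f A - svNetwork v w (N ε) (φ ε) A) 2
          (cubeMeasure.map (hsSigma ω r s v w)) ≤ ENNReal.ofReal ε) ∧
      ∀ δ : ℝ, 0 < δ → ∃ C : ℝ, 0 < C ∧ ∀ ε ∈ Ioc (0 : ℝ) 1,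
        ((∑ j ∈ Finset.range (N ε), p ε j : ℕ) : ℝ) ≤
          C * ε ^ (-1 / (s - 1 / 2) - β - δ) * (1 + |Real.log ε|) ^ κ := by
  have hsum : Summable fun j => ω j ^ (2 * s) := by
    simpa using hωsum (2 * s - 1) (by linarith)
  have hs' : 0 < s - 1 / 2 := by linarith
  have hM : ∀ j, 0 < r * ω j ^ s := fun j => mul_pos hr (Real.rpow_pos_of_pos (hω j) s)
  have hL' : (0 : ℝ) < L := hL
  obtain ⟨n, hn, hnq⟩ := exists_truncation hω hωmono hωsum hs
    (c := 1 / (2 * (L * r) ^ 2)) (by positivity)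
  have hNq := truncation_level_le hω hωmono hωsum (one_div_pos.2 hs') hnq
  obtain ⟨K, hK, hnet⟩ := hsurr.exists_net h𝒜 hh hf hL
  set S : ℝ := ∑' j, ω j ^ (2 * s)
  obtain ⟨c, hc, hc1, hcS⟩ := exists_pos_le_one_sq_mul_le_half
    (B := (L * r) ^ 2 * S) (mul_nonneg (sq_nonneg _)
      (tsum_nonneg fun j => Real.rpow_nonneg (hω j).le _))
  have hcε : ∀ ε ∈ Ioc (0 : ℝ) 1, c * ε ∈ Ioc (0 : ℝ) 1 := fun ε hε =>
    ⟨mul_pos hc hε.1, mul_le_one₀ hc1 hε.1.le hε.2⟩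
  have hex : ∀ (ε : ℝ) (j : ℕ), ∃ (φ : ℝ → ℝ) (m : ℕ), Measurable φ ∧ (ε ∈ Ioc (0 : ℝ) 1 →
      IsScalarNet 𝒜 h φ m ∧ (m : ℝ) ≤ K * (c * ε) ^ (-β) * (1 + |Real.log (c * ε)|) ^ κ ∧
      ∫⁻ u, ENNReal.ofReal ((f (Real.toNNReal (r * ω j ^ s * |(u j : ℝ)|)) -
        φ (r * ω j ^ s * |(u j : ℝ)|)) ^ 2) ∂cubeMeasure ≤
          ENNReal.ofReal ((L * (r * ω j ^ s) * (c * ε)) ^ 2)) := by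
    intro ε j
    by_cases hε : ε ∈ Ioc (0 : ℝ) 1
    · obtain ⟨φ, m, h1, h2, h3⟩ := hnet (r * ω j ^ s) (hM j) (c * ε) (hcε ε hε)
      refine ⟨φ, m, h1.measurable h𝒜, fun _ => ⟨h1, h2, ?_⟩⟩
      have := h3 (r * ω j ^ s) (hM j) le_rfl j
      rwa [div_self (hM j).ne', one_mul] at this
    · exact ⟨0, 0, measurable_const, fun h => absurd h hε⟩
  choose φ p hφm hφ using hex
  refine ⟨fun ε => n ε + 1, φ, p, fun ε hε j _ => (hφ ε j hε).1, fun v w hv hw ε hε => ?_,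
    fun δ hδ => ?_⟩
  · refine eLpNorm_svCalc_sub_svNetwork_le hf hf0 hω hsum hr hv hw (hφm ε) hε.1.le
      (e := fun j => (L * (r * ω j ^ s) * (c * ε)) ^ 2) (fun j => sq_nonneg _)
      (fun j _ => (hφ ε j hε).2.2) ?_ ?_
    · have e : ∀ j, (L * (r * ω j ^ s) * (c * ε)) ^ 2 =
          c ^ 2 * (L * r) ^ 2 * ε ^ 2 * ω j ^ (2 * s) := fun j => by
        rw [show ω j ^ (2 * s) = (ω j ^ s) ^ 2 by
          rw [← Real.rpow_mul_natCast (hω _).le, Nat.cast_ofNat, mul_comm s]]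
        ring
      simp only [e]
      rw [← Finset.mul_sum]
      have h1 := hsum.sum_le_tsum (Finset.range (n ε + 1))
        fun j _ => Real.rpow_nonneg (hω j).le _
      calc _ ≤ c ^ 2 * (L * r) ^ 2 * ε ^ 2 * S := by gcongr
        _ = c ^ 2 * ((L * r) ^ 2 * S) * ε ^ 2 := by ring
        _ ≤ 1 / 2 * ε ^ 2 := by gcongr
        _ = _ := by ring
    · calc _ ≤ (L * r) ^ 2 * (1 / (2 * (L * r) ^ 2) * ε ^ 2) := by
            gcongr
            exact hn ε hε
        _ = _ := by field_simp
  · obtain ⟨C, hC, hCε⟩ := hNq (1 / (s - 1 / 2) + δ) (by linarith)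
    refine ⟨C * (K * c⁻¹ ^ β * (1 + |Real.log c⁻¹| + 1) ^ κ), by positivity, fun ε hε => ?_⟩
    have hcost := surrogate_cost_le hK.le hβ hκ (inv_pos.2 hc) zero_le_one hε (hcε ε hε)
      (by rw [mul_inv, Real.rpow_neg_one])
    push_cast
    calc ∑ j ∈ Finset.range (n ε + 1), (p ε j : ℝ)
        ≤ ∑ j ∈ Finset.range (n ε + 1), (K * c⁻¹ ^ β * (1 + |Real.log c⁻¹| + 1) ^ κ *
            ε ^ (-(1 * β)) * (1 + |Real.log ε|) ^ κ) :=
          Finset.sum_le_sum fun j _ => (hφ ε j hε).2.1.trans hcost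
      _ = ((n ε + 1 : ℕ) : ℝ) * (K * c⁻¹ ^ β * (1 + |Real.log c⁻¹| + 1) ^ κ *
            ε ^ (-(1 * β)) * (1 + |Real.log ε|) ^ κ) := by
          rw [Finset.sum_const, Finset.card_range, nsmul_eq_mul]
      _ ≤ C * ε ^ (-(1 / (s - 1 / 2) + δ)) * (K * c⁻¹ ^ β * (1 + |Real.log c⁻¹| + 1) ^ κ *
            ε ^ (-(1 * β)) * (1 + |Real.log ε|) ^ κ) := by
          refine mul_le_mul_of_nonneg_right (hCε ε hε) ?_
          have := hε.1
          positivity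
      _ = _ := by
          rw [show -1 / (s - 1 / 2) - β - δ = -(1 / (s - 1 / 2) + δ) + -(1 * β) by ring,
            Real.rpow_add hε.1]
          ring

/-- With one common surrogate on `[0, r ω₀ˢ]` the mean square error at the `j`-th singular value is
amplified by `(ω₀ / ωⱼ)ˢ ≤ (ω₀ / ωₙ)ˢ`, where `n` is the last retained index. The accuracy
`c ε (ωₙˢ / (n + 1))^{1/2}` compensates for this and for the number of retained singular values. -/
theorem exists_common_network (𝕜 : Type*) [RCLike 𝕜]
    (H₁ : Type*) [NormedAddCommGroup H₁] [InnerProductSpace 𝕜 H₁] [CompleteSpace H₁]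
    (H₂ : Type*) [NormedAddCommGroup H₂] [InnerProductSpace 𝕜 H₂] [CompleteSpace H₂]
    (hf : LipschitzWith L f) (hf0 : f 0 = 0) (hL : 0 < L)
    (h𝒜 : ∀ a ∈ 𝒜, Measurable a) (hh : 1 ≤ h)
    (hβ : 0 ≤ β) (hκ : 0 ≤ κ) (hsurr : SurrogateProperty 𝒜 h β κ)
    (hω : ∀ j, 0 < ω j) (hωmono : Antitone ω)
    (hωsum : ∀ η : ℝ, 0 < η → Summable fun j => ω j ^ (1 + η)) (hr : 0 < r) (hs : 1 / 2 < s) :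
    ∃ (N : ℝ → ℕ) (φ : ℝ → ℝ → ℝ) (p : ℝ → ℕ),
      (∀ ε ∈ Ioc (0 : ℝ) 1, IsScalarNet 𝒜 h (φ ε) (p ε)) ∧
      (∀ (v : ℕ → H₁) (w : ℕ → H₂), Orthonormal 𝕜 v → Orthonormal 𝕜 w → ∀ ε ∈ Ioc (0 : ℝ) 1,
        eLpNorm (fun A : HS 𝕜 H₁ H₂ => svCalc f A - svNetwork v w (N ε) (fun _ => φ ε) A) 2
          (cubeMeasure.map (hsSigma ω r s v w)) ≤ ENNReal.ofReal ε) ∧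
      ∀ δ : ℝ, 0 < δ → ∃ C : ℝ, 0 < C ∧ ∀ ε ∈ Ioc (0 : ℝ) 1,
        ((N ε * p ε : ℕ) : ℝ) ≤
          C * ε ^ (-1 / (s - 1 / 2) - β * (3 * s / (2 * s - 1)) - δ) *
            (1 + |Real.log ε|) ^ κ := by
  have hsum : Summable fun j => ω j ^ (2 * s) := by
    simpa using hωsum (2 * s - 1) (by linarith)
  have hs' : 0 < s - 1 / 2 := by linarith
  have hs0 : 0 < s := by linarith
  have hωs : ∀ j, 0 < ω j ^ s := fun j => Real.rpow_pos_of_pos (hω j) s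
  have hM : ∀ j, 0 < r * ω j ^ s := fun j => mul_pos hr (hωs j)
  have hL' : (0 : ℝ) < L := hL
  have hmono : ∀ {i j : ℕ}, i ≤ j → ω j ^ s ≤ ω i ^ s := fun hij =>
    Real.rpow_le_rpow (hω _).le (hωmono hij) hs0.le
  obtain ⟨n, hn, hnq⟩ := exists_truncation hω hωmono hωsum hs
    (c := 1 / (2 * (L * r) ^ 2)) (by positivity)
  have hNq := truncation_level_le hω hωmono hωsum (one_div_pos.2 hs') hnq
  obtain ⟨K, hK, hnet⟩ := hsurr.exists_net h𝒜 hh hf hL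
  set M : ℝ := r * ω 0 ^ s with hMdef
  have hM0 : 0 < M := hM 0
  obtain ⟨c, hc, hc1, hcB⟩ := exists_pos_le_one_sq_mul_le_half
    (B := ω 0 ^ s * ((L * M) ^ 2 + 1)) (by have := hωs 0; positivity)
  let acc : ℝ → ℝ := fun ε => c * ε * √(ω (n ε) ^ s / (n ε + 1 : ℕ))
  have hquot : ∀ ε, 0 < ω (n ε) ^ s / (n ε + 1 : ℕ) := fun ε =>
    div_pos (hωs _) (by positivity)
  have haccsq : ∀ ε, acc ε ^ 2 = c ^ 2 * ε ^ 2 * (ω (n ε) ^ s / (n ε + 1 : ℕ)) := fun ε => by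
    rw [mul_pow, Real.sq_sqrt (hquot ε).le, mul_pow]
  have hacc : ∀ ε ∈ Ioc (0 : ℝ) 1, acc ε ∈ Ioc (0 : ℝ) 1 := by
    intro ε hε
    have hpos : 0 < acc ε := mul_pos (mul_pos hc hε.1) (Real.sqrt_pos.2 (hquot ε))
    refine ⟨hpos, ?_⟩
    rw [← sq_le_one_iff₀ hpos.le, haccsq]
    have h1 : ω (n ε) ^ s / (n ε + 1 : ℕ) ≤ ω 0 ^ s :=
      (div_le_self (hωs _).le (by exact_mod_cast Nat.succ_pos _)).trans (hmono (Nat.zero_le _))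
    have h2 : ε ^ 2 ≤ 1 := pow_le_one₀ hε.1.le hε.2
    have h3 : c ^ 2 * ω 0 ^ s ≤ 1 / 2 := by
      have : 0 ≤ c ^ 2 * (ω 0 ^ s * (L * M) ^ 2) := by have := hωs 0; positivity
      nlinarith
    calc c ^ 2 * ε ^ 2 * (ω (n ε) ^ s / (n ε + 1 : ℕ)) ≤ c ^ 2 * 1 * ω 0 ^ s := by
          have := (hquot ε).le
          gcongr
      _ ≤ 1 := by linarith
  have hex : ∀ ε : ℝ, ∃ (φ : ℝ → ℝ) (m : ℕ), Measurable φ ∧ (ε ∈ Ioc (0 : ℝ) 1 →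
      IsScalarNet 𝒜 h φ m ∧ (m : ℝ) ≤ K * acc ε ^ (-β) * (1 + |Real.log (acc ε)|) ^ κ ∧
      ∀ j, ∫⁻ u, ENNReal.ofReal ((f (Real.toNNReal (r * ω j ^ s * |(u j : ℝ)|)) -
        φ (r * ω j ^ s * |(u j : ℝ)|)) ^ 2) ∂cubeMeasure ≤
          ENNReal.ofReal (M / (r * ω j ^ s) * (L * M * acc ε) ^ 2)) := by
    intro ε
    by_cases hε : ε ∈ Ioc (0 : ℝ) 1
    · obtain ⟨φ, m, h1, h2, h3⟩ := hnet M hM0 (acc ε) (hacc ε hε)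
      exact ⟨φ, m, h1.measurable h𝒜, fun _ => ⟨h1, h2, fun j => h3 _ (hM j)
        (mul_le_mul_of_nonneg_left (hmono (Nat.zero_le j)) hr.le) j⟩⟩
    · exact ⟨0, 0, measurable_const, fun h => absurd h hε⟩
  choose φ p hφm hφ using hex
  refine ⟨fun ε => n ε + 1, φ, p, fun ε hε => (hφ ε hε).1, fun v w hv hw ε hε => ?_,
    fun δ hδ => ?_⟩
  · refine eLpNorm_svCalc_sub_svNetwork_le hf hf0 hω hsum hr hv hw (fun _ => hφm ε) hε.1.le
      (e := fun j => M / (r * ω j ^ s) * (L * M * acc ε) ^ 2)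
      (fun j => mul_nonneg (div_pos hM0 (hM j)).le (sq_nonneg _))
      (fun j _ => (hφ ε hε).2.2 j) ?_ ?_
    · have h1 : ∀ j ∈ Finset.range (n ε + 1), M / (r * ω j ^ s) * (L * M * acc ε) ^ 2 ≤
          ω 0 ^ s / ω (n ε) ^ s * (L * M * acc ε) ^ 2 := by
        intro j hj
        rw [hMdef, mul_div_mul_left _ _ hr.ne']
        have h2 := hmono (Nat.lt_succ_iff.1 (Finset.mem_range.1 hj))
        have := (hωs 0).le
        have := hωs (n ε)
        gcongr
      refine (Finset.sum_le_sum h1).trans ?_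
      rw [Finset.sum_const, Finset.card_range, nsmul_eq_mul, mul_pow, haccsq]
      have hne := (hωs (n ε)).ne'
      have hne' : ((n ε + 1 : ℕ) : ℝ) ≠ 0 := by positivity
      calc _ = c ^ 2 * (ω 0 ^ s * (L * M) ^ 2) * ε ^ 2 := by
            generalize ω (n ε) ^ s = x at *
            generalize ((n ε + 1 : ℕ) : ℝ) = y at *
            field_simp
        _ ≤ c ^ 2 * (ω 0 ^ s * ((L * M) ^ 2 + 1)) * ε ^ 2 := by
            have := (hωs 0).le
            gcongr
            linarith
        _ ≤ 1 / 2 * ε ^ 2 := by gcongr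
        _ = _ := by ring
    · calc _ ≤ (L * r) ^ 2 * (1 / (2 * (L * r) ^ 2) * ε ^ 2) := by
            gcongr
            exact hn ε hε
        _ = _ := by field_simp
  · -- the loss `θ` in the truncation level enters the total exponent with this factor
    set D : ℝ := 1 + β * ((1 + s) / 2) with hD
    have hDpos : 0 < D := by positivity
    set q : ℝ := 1 / (s - 1 / 2) + δ / D with hq
    have hqpos : 0 < q := by positivity
    have hq₀ : 1 / (s - 1 / 2) < q := by
      have : 0 < δ / D := by positivity
      linarith
    obtain ⟨C₁, hC₁, hN⟩ := hNq q hq₀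
    obtain ⟨C₂, hC₂, hX⟩ := hnq q hq₀
    set τ : ℝ := 1 + q * (1 + s) / 2 with hτ
    have hτ0 : 0 ≤ τ := by positivity
    -- `acc⁻¹ = c⁻¹ ε⁻¹ ((n + 1) ωₙ⁻ˢ)^{1/2}`, and both factors are bounded by powers of `ε`
    set C₃ : ℝ := c⁻¹ * √(C₁ * C₂ ^ s) with hC₃
    have hC₃pos : 0 < C₃ := by positivity
    have hinv : ∀ ε ∈ Ioc (0 : ℝ) 1, (acc ε)⁻¹ ≤ C₃ * ε ^ (-τ) := by
      intro ε hε
      have hε0 := hε.1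
      have h1 : (ω (n ε) ^ s / (n ε + 1 : ℕ))⁻¹ ≤ C₁ * C₂ ^ s * (ε ^ (-(q * (1 + s) / 2))) ^ 2 := by
        have h2 := Real.rpow_le_rpow (inv_nonneg.2 (hω (n ε)).le) (hX ε hε) hs0.le
        rw [Real.inv_rpow (hω _).le, Real.mul_rpow hC₂.le (Real.rpow_nonneg hε0.le _),
          ← Real.rpow_mul hε0.le] at h2
        rw [inv_div, div_eq_mul_inv]
        refine (mul_le_mul (hN ε hε) h2 (inv_nonneg.2 (hωs _).le) (by positivity)).trans_eq ?_
        rw [← Real.rpow_mul_natCast hε0.le, Nat.cast_ofNat,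
          show -(q * (1 + s) / 2) * 2 = -q + -q * s by ring, Real.rpow_add hε0]
        ring
      have h3 := Real.sqrt_le_sqrt h1
      rw [Real.sqrt_inv, Real.sqrt_mul (by positivity), Real.sqrt_sq (by positivity)] at h3
      calc (acc ε)⁻¹ = c⁻¹ * ε⁻¹ * (√(ω (n ε) ^ s / (n ε + 1 : ℕ)))⁻¹ := by
            simp only [acc, mul_inv]
        _ ≤ c⁻¹ * ε⁻¹ * (√(C₁ * C₂ ^ s) * ε ^ (-(q * (1 + s) / 2))) := by gcongr
        _ = _ := by
            rw [hC₃, hτ, neg_add, Real.rpow_add hε0, Real.rpow_neg_one]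
            ring
    refine ⟨C₁ * (K * C₃ ^ β * (1 + |Real.log C₃| + τ) ^ κ), by positivity, fun ε hε => ?_⟩
    have hcost := surrogate_cost_le hK.le hβ hκ hC₃pos hτ0 hε (hacc ε hε) (hinv ε hε)
    have hp := (hφ ε hε).2.1.trans hcost
    -- `1 / (s - 1/2) = 2 / (2s - 1)`, hence `1 + (1 + s) / (2s - 1) = 3s / (2s - 1)`
    have hexp : -1 / (s - 1 / 2) - β * (3 * s / (2 * s - 1)) - δ = -q + -(τ * β) := by
      have h1 : 2 * s - 1 ≠ 0 := by linarith
      have h2 : s - 1 / 2 = (2 * s - 1) / 2 := by ring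
      have h3 : δ / D * D = δ := div_mul_cancel₀ _ hDpos.ne'
      have h4 : q + τ * β =
          1 / (s - 1 / 2) + β * (1 + 1 / (s - 1 / 2) * ((1 + s) / 2)) + δ / D * D := by
        rw [hτ, hq]
        nth_rewrite 4 [hD]
        ring
      have h5 : 1 + 1 / (s - 1 / 2) * ((1 + s) / 2) = 3 * s / (2 * s - 1) := by
        rw [h2]
        field_simp
        ring
      rw [h3, h5] at h4
      have h6 : -1 / (s - 1 / 2) = -(1 / (s - 1 / 2)) := by ring
      rw [h6]
      linarith
    rw [hexp, Nat.cast_mul, Real.rpow_add hε.1]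
    have hε0 := hε.1
    calc ((n ε + 1 : ℕ) : ℝ) * p ε ≤ C₁ * ε ^ (-q) * (K * C₃ ^ β * (1 + |Real.log C₃| + τ) ^ κ *
          ε ^ (-(τ * β)) * (1 + |Real.log ε|) ^ κ) :=
          mul_le_mul (hN ε hε) hp (by positivity) (by positivity)
      _ = _ := by ring

end Rates

theorem mainTheorem6 {𝕜 : Type*} [RCLike 𝕜]
    {H₁ : Type*} [NormedAddCommGroup H₁] [InnerProductSpace 𝕜 H₁] [CompleteSpace H₁]
    [TopologicalSpace.SeparableSpace H₁]
    {H₂ : Type*} [NormedAddCommGroup H₂] [InnerProductSpace 𝕜 H₂] [CompleteSpace H₂]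
    [TopologicalSpace.SeparableSpace H₂]
    (f : ℝ≥0 → ℝ) (L : ℝ≥0) (hf : LipschitzWith L f) (hf0 : f 0 = 0)
    (𝒜 : Set (ℝ → ℝ)) (h𝒜 : ∀ a ∈ 𝒜, Measurable a) (h : ℕ) (hh : 1 ≤ h)
    (β κ : ℝ) (hβ : 0 ≤ β) (hκ : 0 ≤ κ) (hsurr : SurrogateProperty 𝒜 h β κ)
    (ω : ℕ → ℝ) (hω : ∀ j, 0 < ω j) (hωmono : Antitone ω)
    (hωsum : ∀ η : ℝ, 0 < η → Summable fun j => ω j ^ (1 + η))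
    (r s : ℝ) (hr : 0 < r) (hs : 1 / 2 < s) :
    -- the functional calculus is well defined on `S₂(H₁, H₂)` and does not depend on the SVD
    (∀ A : HS 𝕜 H₁ H₂, (∃ a v w, IsSVD A a v w) ∧ ∀ a v w, IsSVD A a v w →
      HasSum (fun j => ((f (a j) : ℝ) : 𝕜) • (dyad (w j) (v j) : HS 𝕜 H₁ H₂)) (svCalc f A)) ∧
    -- it is Lipschitz with the constant of `f`
    LipschitzWith L (svCalc f : HS 𝕜 H₁ H₂ → HS 𝕜 H₁ H₂) ∧
    -- `σ_r^s` takes values in the cube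
    (∀ (v : ℕ → H₁) (w : ℕ → H₂), Orthonormal 𝕜 v → Orthonormal 𝕜 w →
      ∀ u : ℕ → Icc (-1 : ℝ) 1,
        IsSVD (hsSigma ω r s v w u : HS 𝕜 H₁ H₂) (fun j => Real.toNNReal (r * ω j ^ s * |(u j : ℝ)|))
          v (fun j => ((Real.sign (u j) : ℝ) : 𝕜) • w j) ∧
        (hsSigma ω r s v w u : HS 𝕜 H₁ H₂) ∈ hsCube 𝕜 H₁ H₂ ω r s) ∧
    -- approximation by networks, one scalar surrogate for each retained singular value
    (∃ (N : ℝ → ℕ) (φ : ℝ → ℕ → ℝ → ℝ) (p : ℝ → ℕ → ℕ),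
      (∀ ε ∈ Ioc (0 : ℝ) 1, ∀ j < N ε, IsScalarNet 𝒜 h (φ ε j) (p ε j)) ∧
      (∀ (v : ℕ → H₁) (w : ℕ → H₂), Orthonormal 𝕜 v → Orthonormal 𝕜 w → ∀ ε ∈ Ioc (0 : ℝ) 1,
        eLpNorm (fun A : HS 𝕜 H₁ H₂ => svCalc f A - svNetwork v w (N ε) (φ ε) A) 2
          (cubeMeasure.map (hsSigma ω r s v w)) ≤ ENNReal.ofReal ε) ∧
      ∀ δ : ℝ, 0 < δ → ∃ C : ℝ, 0 < C ∧ ∀ ε ∈ Ioc (0 : ℝ) 1,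
        ((∑ j ∈ Finset.range (N ε), p ε j : ℕ) : ℝ) ≤
          C * ε ^ (-1 / (s - 1 / 2) - β - δ) * (1 + |Real.log ε|) ^ κ) ∧
    -- approximation by networks, one common scalar surrogate for all retained singular values
    (∃ (N : ℝ → ℕ) (φ : ℝ → ℝ → ℝ) (p : ℝ → ℕ),
      (∀ ε ∈ Ioc (0 : ℝ) 1, IsScalarNet 𝒜 h (φ ε) (p ε)) ∧
      (∀ (v : ℕ → H₁) (w : ℕ → H₂), Orthonormal 𝕜 v → Orthonormal 𝕜 w → ∀ ε ∈ Ioc (0 : ℝ) 1,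
        eLpNorm (fun A : HS 𝕜 H₁ H₂ => svCalc f A - svNetwork v w (N ε) (fun _ => φ ε) A) 2
          (cubeMeasure.map (hsSigma ω r s v w)) ≤ ENNReal.ofReal ε) ∧
      ∀ δ : ℝ, 0 < δ → ∃ C : ℝ, 0 < C ∧ ∀ ε ∈ Ioc (0 : ℝ) 1,
        ((N ε * p ε : ℕ) : ℝ) ≤
          C * ε ^ (-1 / (s - 1 / 2) - β * (3 * s / (2 * s - 1)) - δ) *
            (1 + |Real.log ε|) ^ κ) := by
  have hsum : Summable fun j => ω j ^ (2 * s) := by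
    simpa using hωsum (2 * s - 1) (by linarith)
  -- the rates use a positive Lipschitz constant, which covers `L = 0`
  have hf' : LipschitzWith (L + 1) f := hf.weaken le_self_add
  have hL' : 0 < L + 1 := by positivity
  exact ⟨fun A => ⟨exists_isSVD A, fun a v w hA => hA.hasSum_svCalc hf hf0⟩,
    lipschitzWith_svCalc hf hf0,
    fun v w hv hw u => ⟨isSVD_hsSigma hω hsum hr hv hw u, hsSigma_mem_hsCube hω hsum hr hv hw u⟩,
    exists_individual_networks 𝕜 H₁ H₂ hf' hf0 hL' h𝒜 hh hβ hκ hsurr hω hωmono hωsum hr hs,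
    exists_common_network 𝕜 H₁ H₂ hf' hf0 hL' h𝒜 hh hβ hκ hsurr hω hωmono hωsum hr hs⟩
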